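/- For $n\in\mathbb N=\{1,2,\dots\}$ let $\Phi_n$ be the class of real-valued continuous functions $f$ on $\mathbb R_+=[0,\infty)$ that are radial positive definite on $\mathbb R^n$, i.e. such that $$\sum_{k,j=1}^m f(|x_k-x_j|)\,\xi_j\overline{\xi_k}\ \ge\ 0$$ for all finite families of points $x_1,\dots,x_m\in\mathbb R^n$ and all $\xi_1,\dots,\xi_m\in\mathbb C$, where $|\cdot|$ is the Euclidean norm. Let $\Omega_n$ be the Schoenberg kernel $$\Omega_n(s)=\Gamma(q+1)\Bigl(\frac2s\Bigr)^q J_q(s)=\sum_{j=0}^\infty\frac{\Gamma(q+1)}{j!\,\Gamma(j+q+1)}\Bigl(-\frac{s^2}{4}\Bigr)^j,\qquad q=\frac n2-1,$$ where $J_q$ is the Bessel function of the first kind of order $q$ (the value at $s=0$ being that of the series). Then for every $n\in\mathbb N$: (i) for all real $a,b\ge 0$ with $a\ne b$, the function $t\mapsto\Omega_n(at)\,\Omega_n(bt)$, $t\ge0$, belongs to $\Phi_n\setminus\Phi_{n+1}$; (ii) the function $t\mapsto\Omega_n(t)^2$, $t\ge0$, belongs to $\Phi_{2n-1}\setminus\Phi_{2n}$.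 -/

import Mathlib

open scoped NNReal ComplexOrder ComplexConjugate

noncomputable section

/-- A real-valued continuous function `f` on `ℝ₊ = [0, ∞)` is a radial positive definite function
on `ℝⁿ` if `∑_{k,j} f(|x_k - x_j|) ξ_j conj(ξ_k) ≥ 0` for all finitely many points `x_k` of `ℝⁿ`
and complex numbers `ξ_k`.  (The order on `ℂ` is the usual partial one: `0 ≤ z` says that
`z` is real and nonnegative.) -/
def IsRadialPosDef (n : ℕ) (f : ℝ≥0 → ℝ) : Prop :=
  Continuous f ∧
    ∀ (m : ℕ) (x : Fin m → EuclideanSpace ℝ (Fin n)) (ξ : Fin m → ℂ),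
      0 ≤ ∑ k, ∑ j, (f ‖x k - x j‖₊ : ℂ) * ξ j * conj (ξ k)

/-- The class `Φ_n` of radial positive definite functions on `ℝⁿ`. -/
def radialPosDefClass (n : ℕ) : Set (ℝ≥0 → ℝ) :=
  {f | IsRadialPosDef n f}

/-- The Bessel function of the first kind of real order `q`, at a positive real argument. -/
def besselJ (q s : ℝ) : ℝ :=
  ∑' j : ℕ, (-1) ^ j / (j.factorial * Real.Gamma (j + q + 1)) * (s / 2) ^ (2 * (j : ℝ) + q)

/-- The Schoenberg kernel `Ω_n`, given by its everywhere convergent power series;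
with `q = n / 2 - 1` it is `Γ(q + 1) (2 / s) ^ q J_q(s)` for `s > 0`. -/
def schoenbergKernel (n : ℕ) (s : ℝ) : ℝ :=
  ∑' j : ℕ, Real.Gamma ((n : ℝ) / 2 - 1 + 1) /
    (j.factorial * Real.Gamma (j + ((n : ℝ) / 2 - 1) + 1)) * (-(s ^ 2 / 4)) ^ j

theorem schoenbergKernel_eq_besselJ (n : ℕ) {s : ℝ} (hs : 0 < s) :
    schoenbergKernel n s =
      Real.Gamma ((n : ℝ) / 2 - 1 + 1) * (2 / s) ^ ((n : ℝ) / 2 - 1) *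
        besselJ ((n : ℝ) / 2 - 1) s := by
  unfold schoenbergKernel besselJ
  rw [← tsum_mul_left]
  refine tsum_congr fun j => ?_
  have h2 : (0 : ℝ) < s / 2 := by positivity
  have h3 : (2 / s : ℝ) = (s / 2)⁻¹ := by rw [inv_div]
  have h4 : (s / 2) ^ (2 * (j : ℝ)) = (s ^ 2 / 4) ^ j := by
    rw [Real.rpow_mul h2.le, Real.rpow_natCast]
    congr 1
    norm_num
    ring
  rw [h3, Real.inv_rpow h2.le, Real.rpow_add h2, h4, neg_pow]
  have h5 : (s / 2) ^ ((n : ℝ) / 2 - 1) ≠ 0 := (Real.rpow_pos_of_pos h2 _).ne'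
  field_simp

end

open scoped NNReal ComplexOrder ComplexConjugate
open Finset MeasureTheory ProbabilityTheory RealInnerProductSpace Metric

noncomputable section

/-! `Ω_n` is the Fourier transform of the uniform probability measure on the unit sphere of `ℝⁿ`.
Hence `Ω_n(a|x|) Ω_n(b|x|)` is the Fourier transform of the law of `a u + b v`, with `u`, `v`
independent and uniform on the sphere, which gives membership in `Φ_n`.

Both negative statements test against Gaussian points. For bounded `f` in `Φ_m` and `X` standard
Gaussian on `ℝᵐ`, put `G(s) = E f(√s |X|)`. Then `G(s + t)` is a positive definite kernel on `[0,
∞)` (`IsRadialPosDef.sum_gaussianMean_nonneg`); in particular `G ≥ 0`.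

For (i), the mean of `Ω_n(r ·)` in dimension `n + 1` is `₁F₁((n+1)/2; n/2; -z)` with `z = r² s / 2`.
Kummer's transformation rewrites it as `e^{-z} ₁F₁(-1/2; n/2; z)`, which is at most `e^{-z} (1 -
z/n)` and so negative for `r² s > 2n`. The product is an average of the functions `Ω_n(t |a u + b
v|)`, and `|a u + b v| ≥ |a - b| > 0`, so one large `s` makes the mean of the product negative.

For (ii) in dimension `2n`, expand `G(s) = ∑ (-1/2)^k μ_k s^k / k!`. Positive definiteness of `G(s +
t)` makes the Hankel matrix of derivatives at `0` positive semidefinite, so that `μ_{2n+1}² ≤ μ_{2n}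
μ_{2n+2}`; but the ratio `μ_{k+1} / μ_k` strictly decreases at `k = 2n`.

For (ii) in dimension `2n - 1`, the coefficients of `Ω_n²` are those of `Ω_{2n-1}(2 ·)` divided by
`∏_{i<k} m_i`, with explicit `m_i ↓ 1`. Multiplying the `k`-th coefficient by `m_{k+N}` preserves
positive definiteness, being the identity plus a nonnegative multiple of an average over dilations.
Applying this for `N = 0, 1, …` and normalising at `k = 0`, the product telescopes in the limit to
`∏_{i<k} 1/m_i`. -/

/-! ### Factorial products, Chu–Vandermonde and the resulting coefficient identities -/

/-- The rising factorial `x (x + 1) ⋯ (x + k - 1)`. -/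
def risingFactorial (x : ℝ) (k : ℕ) : ℝ := ∏ i ∈ range k, (x + i)

/-- The falling factorial `x (x - 1) ⋯ (x - k + 1)`. -/
def fallingFactorial (x : ℝ) (k : ℕ) : ℝ := ∏ i ∈ range k, (x - i)

@[simp] theorem risingFactorial_zero (x : ℝ) : risingFactorial x 0 = 1 := by
  simp [risingFactorial]

@[simp] theorem fallingFactorial_zero (x : ℝ) : fallingFactorial x 0 = 1 := by
  simp [fallingFactorial]

theorem risingFactorial_succ (x : ℝ) (k : ℕ) :
    risingFactorial x (k + 1) = risingFactorial x k * (x + k) := by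
  simp [risingFactorial, prod_range_succ]

theorem fallingFactorial_succ (x : ℝ) (k : ℕ) :
    fallingFactorial x (k + 1) = fallingFactorial x k * (x - k) := by
  simp [fallingFactorial, prod_range_succ]

theorem fallingFactorial_succ' (x : ℝ) (k : ℕ) :
    fallingFactorial x (k + 1) = x * fallingFactorial (x - 1) k := by
  simp only [fallingFactorial, prod_range_succ', Nat.cast_zero, sub_zero]
  rw [mul_comm]
  congr 1
  refine prod_congr rfl fun i _ => ?_
  push_cast
  ring

theorem risingFactorial_pos {x : ℝ} (hx : 0 < x) (k : ℕ) : 0 < risingFactorial x k :=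
  prod_pos fun i _ => by positivity

theorem risingFactorial_mono {x y : ℝ} (hx : 0 ≤ x) (hxy : x ≤ y) (k : ℕ) :
    risingFactorial x k ≤ risingFactorial y k :=
  prod_le_prod (fun i _ => by positivity) fun i _ => by linarith

theorem pow_le_risingFactorial {x : ℝ} (hx : 0 ≤ x) (k : ℕ) : x ^ k ≤ risingFactorial x k := by
  have : ∏ _i ∈ range k, x ≤ risingFactorial x k :=
    prod_le_prod (fun i _ => hx) fun i _ => by
      have : (0 : ℝ) ≤ i := by positivity
      linarith
  simpa using this

theorem Gamma_add_nat_eq {x : ℝ} (hx : 0 < x) (k : ℕ) :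
    Real.Gamma (k + x) = risingFactorial x k * Real.Gamma x := by
  induction k with
  | zero => simp
  | succ k ih =>
    rw [risingFactorial_succ]
    have : ((k + 1 : ℕ) : ℝ) + x = (k + x) + 1 := by push_cast; ring
    rw [this, Real.Gamma_add_one (by positivity), ih]
    ring

/-- Cutting the product after its first `i` factors. It turns the quotient of two rising factorials
into a falling factorial, the form in which Chu–Vandermonde applies. -/
theorem fallingFactorial_mul_risingFactorial (x : ℝ) (i j : ℕ) :
    fallingFactorial (x + (i + j : ℕ) - 1) j * risingFactorial x i = risingFactorial x (i + j) := by
  induction j with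
  | zero => simp
  | succ j ih =>
    rw [fallingFactorial_succ', ← add_assoc, risingFactorial_succ, ← ih]
    have h : x + ((i + j + 1 : ℕ) : ℝ) - 1 = x + (i + j : ℕ) := by push_cast; ring
    rw [h]
    ring

theorem fallingFactorial_eq_smeval (x : ℝ) (k : ℕ) :
    (descPochhammer ℤ k).smeval x = fallingFactorial x k := by
  induction k with
  | zero => simp
  | succ k ih =>
    rw [descPochhammer_succ_right, Polynomial.smeval_mul, ih, fallingFactorial_succ]
    simp [Polynomial.smeval_sub, Polynomial.smeval_natCast]

/-- The Chu–Vandermonde identity. -/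
theorem fallingFactorial_add (x y : ℝ) (k : ℕ) :
    fallingFactorial (x + y) k = ∑ ij ∈ antidiagonal k,
      (k.choose ij.1 : ℝ) * (fallingFactorial x ij.1 * fallingFactorial y ij.2) := by
  simp only [← fallingFactorial_eq_smeval]
  exact Ring.descPochhammer_smeval_add k (Commute.all x y)

theorem choose_div_factorial_of_mem_antidiagonal {k : ℕ} {ij : ℕ × ℕ} (h : ij ∈ antidiagonal k) :
    (k.choose ij.1 : ℝ) = k.factorial / (ij.1.factorial * ij.2.factorial) := by
  obtain ⟨i, j⟩ := ij
  simp only [HasAntidiagonal.mem_antidiagonal] at h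
  subst h
  rw [Nat.cast_add_choose]

/-- The coefficients of the power series of the square of a Bessel-type function. -/
def besselSqCoeff (ν : ℝ) (k : ℕ) : ℝ :=
  fallingFactorial (2 * ν + 2 * k - 2) k / (k.factorial * risingFactorial ν k ^ 2)

/-- Over the common denominator `k! (ν)_k²` the summand becomes a binomial coefficient times two
falling factorials of `ν + k - 1`, and Chu–Vandermonde sums them. -/
theorem sum_antidiagonal_besselSqCoeff {ν : ℝ} (hν : 0 < ν) (k : ℕ) :
    ∑ ij ∈ antidiagonal k, 1 / (ij.1.factorial * risingFactorial ν ij.1) *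
      (1 / (ij.2.factorial * risingFactorial ν ij.2)) = besselSqCoeff ν k := by
  have h : 2 * ν + 2 * (k : ℝ) - 2 = (ν + k - 1) + (ν + k - 1) := by ring
  have hk : (k.factorial : ℝ) ≠ 0 := by positivity
  have hr := (risingFactorial_pos hν k).ne'
  rw [besselSqCoeff, h, fallingFactorial_add, sum_div]
  refine sum_congr rfl fun ij hij => ?_
  rw [choose_div_factorial_of_mem_antidiagonal hij]
  obtain ⟨i, j⟩ := ij
  simp only [HasAntidiagonal.mem_antidiagonal] at hij
  have h1 := fallingFactorial_mul_risingFactorial ν i j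
  have h2 := fallingFactorial_mul_risingFactorial ν j i
  rw [add_comm j i] at h2
  rw [hij] at h1 h2
  have hi := (risingFactorial_pos hν i).ne'
  have hj := (risingFactorial_pos hν j).ne'
  dsimp only
  rw [← eq_div_iff hi] at h1
  rw [← eq_div_iff hj] at h2
  rw [h1, h2]
  field_simp

theorem besselSqCoeff_pos {ν : ℝ} (hν : 0 < ν) (k : ℕ) : 0 < besselSqCoeff ν k := by
  rw [← sum_antidiagonal_besselSqCoeff hν]
  refine sum_pos (fun ij _ => ?_) ⟨(0, k), by simp⟩
  have h1 := risingFactorial_pos hν ij.1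
  have h2 := risingFactorial_pos hν ij.2
  positivity

@[simp] theorem besselSqCoeff_zero (ν : ℝ) : besselSqCoeff ν 0 = 1 := by simp [besselSqCoeff]

/-- Kept free of division because `2ν + k - 1` vanishes at `ν = 1/2`, `k = 0`, a case that occurs
for `n = 1`. -/
theorem besselSqCoeff_succ {ν : ℝ} (hν : 0 < ν) (k : ℕ) :
    besselSqCoeff ν (k + 1) * ((2 * ν + k - 1) * (k + 1) * (ν + k)) =
      besselSqCoeff ν k * (2 * (2 * ν + 2 * k - 1)) := by
  have hr := (risingFactorial_pos hν k).ne'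
  have hk : (k.factorial : ℝ) ≠ 0 := by positivity
  have h0 : ν + k ≠ 0 := by positivity
  have hk1 : (k : ℝ) + 1 ≠ 0 := by positivity
  have key : fallingFactorial (2 * ν + 2 * (k + 1 : ℕ) - 2) (k + 1) * (2 * ν + k - 1) =
      (2 * ν + 2 * k) * (2 * ν + 2 * k - 1) * fallingFactorial (2 * ν + 2 * k - 2) k := by
    rw [fallingFactorial_succ']
    cases k with
    | zero => simp
    | succ k =>
      rw [fallingFactorial_succ', fallingFactorial_succ]
      have e1 : 2 * ν + 2 * ((k + 1 + 1 : ℕ) : ℝ) - 2 - 1 - 1 = 2 * ν + 2 * (k + 1 : ℕ) - 2 := by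
        push_cast; ring
      rw [e1]
      push_cast
      ring
  rw [besselSqCoeff, besselSqCoeff, risingFactorial_succ, Nat.factorial_succ]
  generalize fallingFactorial (2 * ν + 2 * (k + 1 : ℕ) - 2) (k + 1) = A at key ⊢
  generalize fallingFactorial (2 * ν + 2 * k - 2) k = B at key ⊢
  push_cast
  field_simp
  linear_combination key

/-- The coefficient form of Kummer's transformation `₁F₁(ν + 1/2; ν; -z) = e^{-z} ₁F₁(-1/2; ν; z)`:
Chu–Vandermonde with the arguments `1/2` and `ν + k - 1`. -/
theorem sum_antidiagonal_kummer {ν : ℝ} (hν : 0 < ν) (k : ℕ) :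
    ∑ ij ∈ antidiagonal k, fallingFactorial (1 / 2) ij.1 / (ij.1.factorial * risingFactorial ν ij.1) *
      (1 / ij.2.factorial) = risingFactorial (ν + 1 / 2) k / (k.factorial * risingFactorial ν k) := by
  have hk : (k.factorial : ℝ) ≠ 0 := by positivity
  have hr := (risingFactorial_pos hν k).ne'
  have h := fallingFactorial_mul_risingFactorial (ν + 1 / 2) 0 k
  rw [zero_add, risingFactorial_zero, mul_one] at h
  have e : ν + 1 / 2 + (k : ℝ) - 1 = 1 / 2 + (ν + k - 1) := by ring
  rw [← h, e, fallingFactorial_add, sum_div]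
  refine sum_congr rfl fun ij hij => ?_
  rw [choose_div_factorial_of_mem_antidiagonal hij]
  obtain ⟨i, j⟩ := ij
  simp only [HasAntidiagonal.mem_antidiagonal] at hij
  have h1 := fallingFactorial_mul_risingFactorial ν i j
  rw [hij] at h1
  have hi := (risingFactorial_pos hν i).ne'
  dsimp only
  rw [← eq_div_iff hi] at h1
  rw [h1]
  field_simp

/-- The left side is the rising factorial of `-1/2`, whose only negative factor is the first. So
every nonconstant coefficient of `₁F₁(-1/2; ν; z)` is nonpositive. -/
theorem neg_one_pow_mul_fallingFactorial_half_nonpos (k : ℕ) :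
    (-1) ^ (k + 1) * fallingFactorial (1 / 2) (k + 1) ≤ 0 := by
  induction k with
  | zero => norm_num [fallingFactorial]
  | succ k ih =>
    rw [fallingFactorial_succ]
    have h : (-1 : ℝ) ^ (k + 1 + 1) * (fallingFactorial (1 / 2) (k + 1) * (1 / 2 - (k + 1 : ℕ))) =
        ((-1) ^ (k + 1) * fallingFactorial (1 / 2) (k + 1)) * (k + 1 / 2) := by
      push_cast; ring
    rw [h]
    exact mul_nonpos_of_nonpos_of_nonneg ih (by positivity)

theorem abs_fallingFactorial_half_le (k : ℕ) :
    |fallingFactorial (1 / 2) k| ≤ risingFactorial (1 / 2) k := by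
  rw [fallingFactorial, abs_prod]
  refine prod_le_prod (fun _ _ => abs_nonneg _) fun i _ => ?_
  rw [abs_le]
  constructor <;> linarith [(i.cast_nonneg : (0 : ℝ) ≤ i)]

theorem risingFactorial_add_half_le {ν : ℝ} (hν : 1 / 2 ≤ ν) (k : ℕ) :
    risingFactorial (ν + 1 / 2) k ≤ 2 ^ k * risingFactorial ν k := by
  have : 2 ^ k * risingFactorial ν k = ∏ i ∈ range k, 2 * (ν + i) := by
    rw [risingFactorial, prod_mul_distrib, prod_const, card_range]
  rw [this]
  refine prod_le_prod (fun i _ => by positivity) fun i _ => ?_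
  linarith [(i.cast_nonneg : (0 : ℝ) ≤ i)]

/-! ### The power series of the Schoenberg kernel -/

theorem summable_pow_div_factorial_mul_risingFactorial {ν : ℝ} (hν : 0 < ν) (x : ℝ) :
    Summable fun k : ℕ => |x ^ k / (k.factorial * risingFactorial ν k)| := by
  refine Summable.of_nonneg_of_le (fun _ => abs_nonneg _) (fun k => ?_)
    (Real.summable_pow_div_factorial (|x| / ν))
  have h := risingFactorial_pos hν k
  have h2 := pow_le_risingFactorial hν.le k
  rw [abs_div, abs_pow, abs_of_pos (by positivity : (0 : ℝ) < k.factorial * risingFactorial ν k),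
    div_pow, div_div, mul_comm]
  gcongr

theorem schoenbergKernel_eq_tsum {n : ℕ} (hn : 1 ≤ n) (s : ℝ) :
    schoenbergKernel n s =
      ∑' k : ℕ, (-(s ^ 2 / 4)) ^ k / (k.factorial * risingFactorial (n / 2) k) := by
  have hn' : (0 : ℝ) < n / 2 := by positivity
  refine tsum_congr fun k => ?_
  have h1 : (n : ℝ) / 2 - 1 + 1 = n / 2 := by ring
  have h2 : (k : ℝ) + ((n : ℝ) / 2 - 1) + 1 = k + n / 2 := by ring
  rw [h1, h2, Gamma_add_nat_eq hn']
  have := (Real.Gamma_pos_of_pos hn').ne'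
  have := (risingFactorial_pos hn' k).ne'
  field_simp

theorem hasSum_schoenbergKernel {n : ℕ} (hn : 1 ≤ n) (s : ℝ) :
    HasSum (fun k : ℕ => (-(s ^ 2 / 4)) ^ k / (k.factorial * risingFactorial (n / 2) k))
      (schoenbergKernel n s) := by
  rw [schoenbergKernel_eq_tsum hn]
  exact (summable_pow_div_factorial_mul_risingFactorial (by positivity) _).of_abs.hasSum

theorem hasSum_schoenbergKernel_sq {n : ℕ} (hn : 1 ≤ n) (s : ℝ) :
    HasSum (fun k : ℕ => besselSqCoeff (n / 2) k * (-(s ^ 2 / 4)) ^ k)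
      (schoenbergKernel n s ^ 2) := by
  have hn' : (0 : ℝ) < n / 2 := by positivity
  have hs := summable_pow_div_factorial_mul_risingFactorial hn' (-(s ^ 2 / 4))
  have hs' : Summable fun k : ℕ =>
      ‖(-(s ^ 2 / 4)) ^ k / (k.factorial * risingFactorial (n / 2) k)‖ := hs
  have h1 := summable_norm_sum_mul_antidiagonal_of_summable_norm hs' hs'
  have h2 := tsum_mul_tsum_eq_tsum_sum_antidiagonal_of_summable_norm hs' hs'
  rw [← schoenbergKernel_eq_tsum hn, ← sq] at h2
  rw [h2]
  refine HasSum.congr_fun h1.of_norm.hasSum fun k => ?_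
  rw [← sum_antidiagonal_besselSqCoeff hn', sum_mul]
  refine sum_congr rfl fun ij hij => ?_
  rw [← HasAntidiagonal.mem_antidiagonal.1 hij, pow_add]
  ring

/-! ### The standard Gaussian measure: density and moments -/

section Gaussian

variable {E : Type*} [NormedAddCommGroup E] [InnerProductSpace ℝ E]

variable (E) in
/-- The density of the standard Gaussian measure with respect to the volume. -/
def gaussianDensity (x : E) : ℝ :=
  ((2 * Real.pi) ^ (Module.finrank ℝ E / 2 : ℝ))⁻¹ * Real.exp (-(1 / 2) * ‖x‖ ^ 2)

theorem gaussianDensity_pos (x : E) : 0 < gaussianDensity E x := by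
  unfold gaussianDensity
  positivity

theorem continuous_gaussianDensity : Continuous (gaussianDensity E) := by
  unfold gaussianDensity
  fun_prop

variable [FiniteDimensional ℝ E] [MeasurableSpace E] [BorelSpace E]

theorem integral_gaussianDensity : ∫ x, gaussianDensity E x = 1 := by
  unfold gaussianDensity
  rw [integral_const_mul, GaussianFourier.integral_rexp_neg_mul_sq_norm (by norm_num)]
  have : Real.pi / (1 / 2) = 2 * Real.pi := by ring
  rw [this]
  exact inv_mul_cancel₀ (by positivity)

theorem integrable_gaussianDensity : Integrable (gaussianDensity E) := by
  by_contra h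
  have := integral_undef h
  rw [integral_gaussianDensity] at this
  exact one_ne_zero this

theorem stdGaussian_eq_withDensity :
    stdGaussian E = volume.withDensity fun x => ENNReal.ofReal (gaussianDensity E x) := by
  have : IsFiniteMeasure (volume.withDensity fun x => ENNReal.ofReal (gaussianDensity E x)) :=
    isFiniteMeasure_withDensity_ofReal integrable_gaussianDensity.2
  refine Measure.ext_of_charFun (funext fun t => ?_)
  rw [charFun_stdGaussian, charFun_apply, integral_withDensity_eq_integral_toReal_smul
    (continuous_gaussianDensity.measurable.ennreal_ofReal) (by simp)]
  have h := GaussianFourier.integral_cexp_neg_mul_sq_norm_add (V := E) (b := 1 / 2) (by norm_num)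
    Complex.I t
  have e : ∀ x : E, (ENNReal.ofReal (gaussianDensity E x)).toReal • Complex.exp (⟪x, t⟫ * Complex.I)
      = (((2 * Real.pi) ^ (Module.finrank ℝ E / 2 : ℝ))⁻¹ : ℝ) *
        Complex.exp (-(1 / 2) * ‖x‖ ^ 2 + Complex.I * ⟪t, x⟫) := by
    intro x
    rw [ENNReal.toReal_ofReal (gaussianDensity_pos x).le, gaussianDensity, Complex.real_smul,
      Complex.exp_add, real_inner_comm, mul_comm Complex.I]
    push_cast
    ring
  simp_rw [e]
  rw [integral_const_mul, h]
  have e2 : (Real.pi / (1 / 2) : ℂ) ^ (Module.finrank ℝ E / 2 : ℂ) =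
      (((2 * Real.pi) ^ (Module.finrank ℝ E / 2 : ℝ) : ℝ) : ℂ) := by
    rw [Complex.ofReal_cpow (by positivity)]
    push_cast
    congr 1
    ring
  rw [e2, ← mul_assoc, ← Complex.ofReal_mul, inv_mul_cancel₀ (by positivity), Complex.I_sq]
  simp only [Complex.ofReal_one, one_mul]
  congr 1
  ring

theorem integral_stdGaussian (f : E → ℝ) :
    ∫ x, f x ∂stdGaussian E = ∫ x, f x * gaussianDensity E x := by
  rw [stdGaussian_eq_withDensity, integral_withDensity_eq_integral_toReal_smul
    (continuous_gaussianDensity.measurable.ennreal_ofReal) (by simp)]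
  refine integral_congr_ae (.of_forall fun x => ?_)
  simp [ENNReal.toReal_ofReal (gaussianDensity_pos x).le, mul_comm]

theorem integrable_norm_pow_stdGaussian (k : ℕ) : Integrable (fun x => ‖x‖ ^ k) (stdGaussian E) :=
  (IsGaussian.memLp_id (stdGaussian E) k (by simp)).integrable_norm_pow'

theorem integral_Ioi_pow_mul_exp (q : ℕ) :
    ∫ y in Set.Ioi (0 : ℝ), y ^ q * Real.exp (-(1 / 2) * y ^ 2) =
      2 ^ ((q + 1 : ℝ) / 2) * (1 / 2) * Real.Gamma ((q + 1) / 2) := by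
  have h := integral_rpow_mul_exp_neg_mul_rpow (p := 2) (q := q) (b := 1 / 2) (by norm_num)
    (by linarith [(q.cast_nonneg : (0 : ℝ) ≤ q)]) (by norm_num)
  have e : (1 / 2 : ℝ) ^ (-((q : ℝ) + 1) / 2) = 2 ^ ((q + 1 : ℝ) / 2) := by
    rw [one_div, Real.inv_rpow (by norm_num), ← Real.rpow_neg (by norm_num)]
    congr 1
    ring
  rw [e] at h
  rw [← h]
  refine setIntegral_congr_fun measurableSet_Ioi fun y _ => ?_
  simp

theorem integral_norm_pow_stdGaussian [Nontrivial E] (k : ℕ) :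
    ∫ x, ‖x‖ ^ (2 * k) ∂stdGaussian E = 2 ^ k * risingFactorial (Module.finrank ℝ E / 2) k := by
  have hd : 0 < Module.finrank ℝ E := Module.finrank_pos
  obtain ⟨d, hd'⟩ : ∃ d, Module.finrank ℝ E = d + 1 := ⟨_, (Nat.succ_pred_eq_of_pos hd).symm⟩
  obtain ⟨C, hC⟩ : ∃ C : ℝ, ∀ k : ℕ, ∫ x, ‖x‖ ^ (2 * k) ∂stdGaussian E =
      C * (2 ^ k * risingFactorial (Module.finrank ℝ E / 2) k) := by
    refine ⟨Module.finrank ℝ E * (volume : Measure E).real (ball 0 1) *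
      ((2 * Real.pi) ^ (Module.finrank ℝ E / 2 : ℝ))⁻¹ * 2 ^ (Module.finrank ℝ E / 2 : ℝ) * (1 / 2) *
      Real.Gamma (Module.finrank ℝ E / 2), fun k => ?_⟩
    rw [integral_stdGaussian]
    unfold gaussianDensity
    rw [integral_fun_norm_addHaar volume fun y => y ^ (2 * k) * (((2 * Real.pi) ^
      (Module.finrank ℝ E / 2 : ℝ))⁻¹ * Real.exp (-(1 / 2) * y ^ 2))]
    have e : ∀ y : ℝ, y ^ (Module.finrank ℝ E - 1) • (y ^ (2 * k) * (((2 * Real.pi) ^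
        (Module.finrank ℝ E / 2 : ℝ))⁻¹ * Real.exp (-(1 / 2) * y ^ 2))) =
        ((2 * Real.pi) ^ (Module.finrank ℝ E / 2 : ℝ))⁻¹ *
          (y ^ (d + 2 * k) * Real.exp (-(1 / 2) * y ^ 2)) := by
      intro y
      rw [hd', Nat.add_sub_cancel, smul_eq_mul, pow_add]
      ring
    simp_rw [e]
    rw [integral_const_mul, integral_Ioi_pow_mul_exp]
    have e2 : ((d + 2 * k : ℕ) + 1 : ℝ) / 2 = k + (Module.finrank ℝ E : ℝ) / 2 := by
      rw [hd']; push_cast; ring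
    rw [e2, Gamma_add_nat_eq (by positivity), Real.rpow_add (by norm_num), Real.rpow_natCast,
      nsmul_eq_mul, smul_eq_mul]
    ring
  -- The constant need not be evaluated: at `k = 0` the integral is the total mass, which forces `C
  -- = 1`.
  have h0 := hC 0
  simp only [mul_zero, pow_zero, risingFactorial_zero, mul_one, integral_const,
    probReal_univ, smul_eq_mul] at h0
  rw [hC, ← h0, one_mul]

theorem map_inner_stdGaussian (x : E) :
    (stdGaussian E).map (fun y => ⟪x, y⟫) = (stdGaussian ℝ).map (fun t => ‖x‖ * t) := by
  have : IsProbabilityMeasure ((stdGaussian E).map (fun y => ⟪x, y⟫)) :=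
    Measure.isProbabilityMeasure_map (by fun_prop)
  have : IsProbabilityMeasure ((stdGaussian ℝ).map (fun t => ‖x‖ * t)) :=
    Measure.isProbabilityMeasure_map (by fun_prop)
  refine Measure.ext_of_charFun (funext fun s => ?_)
  rw [charFun_map_mul, charFun_stdGaussian, charFun_apply, integral_map (by fun_prop)
    (by fun_prop)]
  have h := charFun_stdGaussian (E := E) (s • x)
  rw [charFun_apply] at h
  have e : ∀ y : E, ⟪⟪x, y⟫, s⟫ = ⟪y, s • x⟫ := by
    intro y
    rw [real_inner_smul_right, real_inner_comm y x]
    simp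
  simp_rw [e, h, norm_smul, norm_mul, norm_norm, mul_comm]

theorem integral_inner_pow_stdGaussian (x : E) (l : ℕ) :
    ∫ y, ⟪x, y⟫ ^ l ∂stdGaussian E = ‖x‖ ^ l * ∫ t, t ^ l ∂stdGaussian ℝ := by
  have h1 : ∫ y, ⟪x, y⟫ ^ l ∂stdGaussian E = ∫ t, t ^ l ∂(stdGaussian E).map fun y => ⟪x, y⟫ := by
    rw [integral_map (by fun_prop) (by fun_prop)]
  rw [h1, map_inner_stdGaussian, integral_map (by fun_prop) (by fun_prop), ← integral_const_mul]
  simp_rw [mul_pow]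

theorem integral_inner_pow_even_stdGaussian (x : E) (k : ℕ) :
    ∫ y, ⟪x, y⟫ ^ (2 * k) ∂stdGaussian E =
      ‖x‖ ^ (2 * k) * (2 ^ k * risingFactorial (1 / 2) k) := by
  rw [integral_inner_pow_stdGaussian]
  have := integral_norm_pow_stdGaussian (E := ℝ) k
  simp only [Real.norm_eq_abs, Even.pow_abs (even_two_mul k), Module.finrank_self,
    Nat.cast_one] at this
  rw [this]

theorem integral_inner_pow_odd_stdGaussian (x : E) (k : ℕ) :
    ∫ y, ⟪x, y⟫ ^ (2 * k + 1) ∂stdGaussian E = 0 := by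
  rw [integral_stdGaussian]
  have h := integral_neg_eq_self (fun y : E => ⟪x, y⟫ ^ (2 * k + 1) * gaussianDensity E y) volume
  have e : ∀ y : E, ⟪x, -y⟫ ^ (2 * k + 1) * gaussianDensity E (-y) =
      -(⟪x, y⟫ ^ (2 * k + 1) * gaussianDensity E y) := by
    intro y
    rw [inner_neg_right, Odd.neg_pow (odd_two_mul_add_one k), gaussianDensity, gaussianDensity,
      norm_neg]
    ring
  simp_rw [e] at h
  rw [integral_neg] at h
  linarith

/-! ### The uniform measure on the unit sphere -/

variable (E) in
/-- The uniform probability measure on the unit sphere. -/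
def uniformSphere : Measure (sphere (0 : E) 1) :=
  ((volume : Measure E).toSphere Set.univ)⁻¹ • (volume : Measure E).toSphere

instance [Nontrivial E] : IsProbabilityMeasure (uniformSphere E) := by
  have : NeZero (volume : Measure E).toSphere := ⟨Measure.toSphere_ne_zero _⟩
  unfold uniformSphere
  infer_instance

/-- Polar coordinates: for a homogeneous factor the angular and radial variables separate. -/
theorem integral_homogeneous_mul_radial [Nontrivial E] {φ : E → ℝ} {l : ℕ}
    (hφ : ∀ (r : ℝ) (x : E), 0 < r → φ (r • x) = r ^ l * φ x) (h : ℝ → ℝ) :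
    ∫ y, φ y * h ‖y‖ = (∫ u : sphere (0 : E) 1, φ u ∂(volume : Measure E).toSphere) *
      ∫ r : Set.Ioi (0 : ℝ), (r : ℝ) ^ l * h r ∂.volumeIoiPow (Module.finrank ℝ E - 1) :=
  calc
    ∫ y, φ y * h ‖y‖ = ∫ x : ({(0)}ᶜ : Set E), φ x * h ‖x.1‖ ∂((volume : Measure E).comap (↑)) := by
      rw [integral_subtype_comap (measurableSet_singleton _).compl fun x ↦ φ x * h ‖x‖,
        restrict_compl_singleton]
    _ = ∫ p : sphere (0 : E) 1 × Set.Ioi (0 : ℝ), φ p.1 * ((p.2 : ℝ) ^ l * h p.2)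
          ∂(volume : Measure E).toSphere.prod (.volumeIoiPow (Module.finrank ℝ E - 1)) := by
      rw [← (volume : Measure E).measurePreserving_homeomorphUnitSphereProd.integral_comp
        (Homeomorph.measurableEmbedding _)]
      refine integral_congr_ae (.of_forall fun x => ?_)
      have hx : (0 : ℝ) < ‖(x : E)‖ := norm_pos_iff.2 x.2
      simp only [homeomorphUnitSphereProd_apply_fst_coe, homeomorphUnitSphereProd_apply_snd_coe]
      rw [hφ _ _ (inv_pos.2 hx)]
      have : ‖(x : E)‖⁻¹ ^ l * ‖(x : E)‖ ^ l = 1 := by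
        rw [← mul_pow, inv_mul_cancel₀ hx.ne', one_pow]
      linear_combination (-φ x * h ‖(x : E)‖) * this
    _ = _ := integral_prod_mul (fun u : sphere (0 : E) 1 => φ u)
      fun r : Set.Ioi (0 : ℝ) => (r : ℝ) ^ l * h r

/-- The direction of a Gaussian vector is uniformly distributed and independent of its norm. -/
theorem integral_homogeneous_stdGaussian [Nontrivial E] {φ : E → ℝ} {l : ℕ}
    (hφ : ∀ (r : ℝ) (x : E), 0 < r → φ (r • x) = r ^ l * φ x) :
    ∫ y, φ y ∂stdGaussian E = (∫ u, φ u ∂uniformSphere E) * ∫ y, ‖y‖ ^ l ∂stdGaussian E := by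
  have h1 := integral_homogeneous_mul_radial hφ fun r => ((2 * Real.pi) ^
    (Module.finrank ℝ E / 2 : ℝ))⁻¹ * Real.exp (-(1 / 2) * r ^ 2)
  have h2 := integral_homogeneous_mul_radial (E := E) (φ := fun x => ‖x‖ ^ l) (l := l)
    (fun r x hr => by rw [norm_smul, Real.norm_of_nonneg hr.le, mul_pow]) fun r =>
    ((2 * Real.pi) ^ (Module.finrank ℝ E / 2 : ℝ))⁻¹ * Real.exp (-(1 / 2) * r ^ 2)
  rw [integral_stdGaussian, integral_stdGaussian]
  unfold gaussianDensity
  rw [h1, h2, uniformSphere, integral_smul_measure]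
  have h3 : (volume : Measure E).toSphere.real Set.univ ≠ 0 := by
    rw [Measure.real, ENNReal.toReal_ne_zero]
    exact ⟨fun h => Measure.toSphere_ne_zero _ (Measure.measure_univ_eq_zero.1 h),
      measure_ne_top _ _⟩
  simp only [norm_eq_of_mem_sphere, one_pow, integral_const, smul_eq_mul, mul_one,
    ENNReal.toReal_inv, ← measureReal_def]
  rw [mul_assoc, mul_left_comm _ (Measure.real _ _), inv_mul_cancel_left₀ h3]

theorem integral_inner_pow_even_uniformSphere [Nontrivial E] (x : E) (k : ℕ) :
    ∫ u : sphere (0 : E) 1, ⟪x, (u : E)⟫ ^ (2 * k) ∂uniformSphere E =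
      ‖x‖ ^ (2 * k) * (risingFactorial (1 / 2) k / risingFactorial (Module.finrank ℝ E / 2) k) := by
  have h := integral_homogeneous_stdGaussian (E := E) (φ := fun y => ⟪x, y⟫ ^ (2 * k))
    (l := 2 * k) fun r y _ => by rw [real_inner_smul_right, mul_pow]
  have hd : (0 : ℝ) < Module.finrank ℝ E := by exact_mod_cast Module.finrank_pos
  have hp := (risingFactorial_pos (half_pos hd) k).ne'
  rw [integral_inner_pow_even_stdGaussian, integral_norm_pow_stdGaussian,
    ← div_eq_iff (by positivity)] at h
  rw [← h]
  field_simp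

theorem integral_inner_pow_odd_uniformSphere [Nontrivial E] (x : E) (k : ℕ) :
    ∫ u : sphere (0 : E) 1, ⟪x, (u : E)⟫ ^ (2 * k + 1) ∂uniformSphere E = 0 := by
  have h := integral_homogeneous_stdGaussian (E := E) (φ := fun y => ⟪x, y⟫ ^ (2 * k + 1))
    (l := 2 * k + 1) fun r y _ => by rw [real_inner_smul_right, mul_pow]
  rw [integral_inner_pow_odd_stdGaussian] at h
  -- It remains to see that the odd moment of the norm is nonzero. Only even moments are known in
  -- closed form; were the odd one zero, the norm would vanish almost everywhere, and so would its
  -- moment of order `2 (2k + 1)`.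
  refine (mul_eq_zero.1 h.symm).resolve_right (ne_of_gt ?_)
  refine lt_of_le_of_ne (integral_nonneg fun y => by positivity) fun h0 => ?_
  have h1 := (integral_eq_zero_iff_of_nonneg (fun y => by positivity)
    (integrable_norm_pow_stdGaussian (E := E) (2 * k + 1))).1 h0.symm
  have h2 := integral_norm_pow_stdGaussian (E := E) (2 * k + 1)
  have h3 : ∫ y : E, ‖y‖ ^ (2 * (2 * k + 1)) ∂stdGaussian E = 0 := by
    rw [integral_eq_zero_of_ae]
    filter_upwards [h1] with y hy
    simp only [Pi.zero_apply] at hy ⊢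
    rw [mul_comm, pow_mul, hy]
    norm_num
  have hd : (0 : ℝ) < Module.finrank ℝ E := by exact_mod_cast Module.finrank_pos
  have := risingFactorial_pos (half_pos hd) (2 * k + 1)
  rw [h3] at h2
  have : (0 : ℝ) < 2 ^ (2 * k + 1) * risingFactorial (Module.finrank ℝ E / 2) (2 * k + 1) := by
    positivity
  linarith

theorem factorial_two_mul_eq (k : ℕ) :
    ((2 * k).factorial : ℝ) = 4 ^ k * k.factorial * risingFactorial (1 / 2) k := by
  induction k with
  | zero => simp
  | succ k ih =>
    rw [show 2 * (k + 1) = 2 * k + 1 + 1 by ring, Nat.factorial_succ, Nat.factorial_succ,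
      Nat.factorial_succ, risingFactorial_succ]
    push_cast
    rw [ih]
    ring

/-- Termwise integration of the exponential series, dominated by `‖x‖ ^ l / l!` because `u` is a
unit vector. -/
theorem hasSum_integral_cexp_inner_uniformSphere [Nontrivial E] (x : E) :
    HasSum (fun l : ℕ => Complex.I ^ l / l.factorial *
      ((∫ u : sphere (0 : E) 1, ⟪x, (u : E)⟫ ^ l ∂uniformSphere E : ℝ) : ℂ))
      (∫ u : sphere (0 : E) 1, Complex.exp (⟪x, (u : E)⟫ * Complex.I) ∂uniformSphere E) := by
  have hb : ∀ u : sphere (0 : E) 1, |⟪x, (u : E)⟫| ≤ ‖x‖ := fun u => by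
    simpa using abs_real_inner_le_norm x u
  have hF : ∀ l : ℕ, Integrable (fun u : sphere (0 : E) 1 =>
      ((⟪x, (u : E)⟫ : ℂ) * Complex.I) ^ l / l.factorial) (uniformSphere E) := by
    intro l
    exact (Continuous.integrable_of_hasCompactSupport (by fun_prop)
      (HasCompactSupport.of_compactSpace _))
  have hsum := hasSum_integral_of_summable_integral_norm hF (by
    refine Summable.of_nonneg_of_le (fun l => by positivity) (fun l => ?_)
      (Real.summable_pow_div_factorial ‖x‖)
    calc _ ≤ ∫ _ : sphere (0 : E) 1, ‖x‖ ^ l / l.factorial ∂uniformSphere E := by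
          refine integral_mono (hF l).norm (integrable_const _) fun u => ?_
          simp only [norm_div, norm_pow, norm_mul, Complex.norm_real, Complex.norm_I, mul_one,
            Real.norm_eq_abs, RCLike.norm_natCast]
          gcongr
          exact hb u
      _ = _ := by simp)
  have e : ∀ u : sphere (0 : E) 1, ∑' l : ℕ, ((⟪x, (u : E)⟫ : ℂ) * Complex.I) ^ l / l.factorial =
      Complex.exp (⟪x, (u : E)⟫ * Complex.I) := fun u => by
    rw [Complex.exp_eq_exp_ℂ, NormedSpace.exp_eq_tsum_div]
  simp_rw [e] at hsum
  refine HasSum.congr_fun hsum fun l => ?_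
  rw [← integral_complex_ofReal, ← integral_const_mul]
  refine integral_congr_ae (.of_forall fun u => ?_)
  dsimp only
  rw [mul_pow]
  push_cast
  ring

/-- The Schoenberg kernel is the Fourier transform of the uniform measure on the sphere. -/
theorem integral_cexp_inner_uniformSphere [Nontrivial E] (x : E) :
    ∫ u : sphere (0 : E) 1, Complex.exp (⟪x, (u : E)⟫ * Complex.I) ∂uniformSphere E =
      schoenbergKernel (Module.finrank ℝ E) ‖x‖ := by
  have hd : 0 < Module.finrank ℝ E := Module.finrank_pos
  have heven : HasSum (fun k : ℕ => Complex.I ^ (2 * k) / (2 * k).factorial *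
      ((∫ u : sphere (0 : E) 1, ⟪x, (u : E)⟫ ^ (2 * k) ∂uniformSphere E : ℝ) : ℂ))
      (schoenbergKernel (Module.finrank ℝ E) ‖x‖ : ℂ) := by
    refine HasSum.congr_fun (Complex.hasSum_ofReal.2 (hasSum_schoenbergKernel hd ‖x‖)) fun k => ?_
    rw [integral_inner_pow_even_uniformSphere, pow_mul Complex.I, Complex.I_sq]
    have h1 := (risingFactorial_pos (by norm_num : (0 : ℝ) < 1 / 2) k).ne'
    have h2 : (0 : ℝ) < Module.finrank ℝ E := by exact_mod_cast hd
    have h3 := (risingFactorial_pos (half_pos h2) k).ne'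
    have h4 : (-1) ^ k / ((2 * k).factorial : ℝ) * (‖x‖ ^ (2 * k) * (risingFactorial (1 / 2) k /
        risingFactorial (Module.finrank ℝ E / 2) k)) = (-(‖x‖ ^ 2 / 4)) ^ k /
        (k.factorial * risingFactorial (Module.finrank ℝ E / 2) k) := by
      rw [factorial_two_mul_eq, neg_pow (‖x‖ ^ 2 / 4), div_pow, ← pow_mul]
      field_simp
    rw [← h4]
    push_cast
    rfl
  have hodd : HasSum (fun k : ℕ => Complex.I ^ (2 * k + 1) / (2 * k + 1).factorial *
      ((∫ u : sphere (0 : E) 1, ⟪x, (u : E)⟫ ^ (2 * k + 1) ∂uniformSphere E : ℝ) : ℂ)) 0 := by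
    simp_rw [integral_inner_pow_odd_uniformSphere]
    simp [hasSum_zero]
  have h := heven.even_add_odd (f := fun l : ℕ => Complex.I ^ l / l.factorial *
      ((∫ u : sphere (0 : E) 1, ⟪x, (u : E)⟫ ^ l ∂uniformSphere E : ℝ) : ℂ)) hodd
  rw [add_zero] at h
  exact (hasSum_integral_cexp_inner_uniformSphere x).unique h

end Gaussian

/-! ### Radial positive definite functions -/

/-- The kernel is real and symmetric, so its form at `ξ` is the sum of the forms at the real and
imaginary parts; the cross terms cancel. -/
theorem isRadialPosDef_of_real {n : ℕ} {f : ℝ≥0 → ℝ} (hf : Continuous f)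
    (h : ∀ (m : ℕ) (x : Fin m → EuclideanSpace ℝ (Fin n)) (c : Fin m → ℝ),
      0 ≤ ∑ k, ∑ j, f ‖x k - x j‖₊ * c j * c k) : IsRadialPosDef n f := by
  refine ⟨hf, fun m x ξ => ?_⟩
  have h1 := h m x fun k => (ξ k).re
  have h2 := h m x fun k => (ξ k).im
  have hsymm : ∑ k, ∑ j, f ‖x k - x j‖₊ * (ξ j).im * (ξ k).re =
      ∑ k, ∑ j, f ‖x k - x j‖₊ * (ξ j).re * (ξ k).im := by
    rw [sum_comm]
    refine sum_congr rfl fun k _ => sum_congr rfl fun j _ => ?_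
    rw [← nnnorm_neg, neg_sub]
    ring
  rw [Complex.nonneg_iff]
  simp only [Complex.re_sum, Complex.im_sum, Complex.mul_re, Complex.mul_im, Complex.ofReal_re,
    Complex.ofReal_im, Complex.conj_re, Complex.conj_im, zero_mul, sub_zero, add_zero]
  constructor
  · refine (add_nonneg h1 h2).trans_eq ?_
    simp only [← sum_add_distrib]
    refine sum_congr rfl fun k _ => sum_congr rfl fun j _ => ?_
    ring
  · rw [← sub_eq_zero] at hsymm
    rw [← hsymm]
    simp only [← sum_sub_distrib]
    refine sum_congr rfl fun k _ => sum_congr rfl fun j _ => ?_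
    ring

theorem IsRadialPosDef.sum_nonneg {n : ℕ} {f : ℝ≥0 → ℝ} (hf : IsRadialPosDef n f)
    {ι : Type*} [Fintype ι] (x : ι → EuclideanSpace ℝ (Fin n)) (c : ι → ℝ) :
    0 ≤ ∑ k, ∑ j, f ‖x k - x j‖₊ * c j * c k := by
  let e := (Fintype.equivFin ι).symm
  have h := hf.2 _ (fun i => x (e i)) fun i => (c (e i) : ℂ)
  have h2 : 0 ≤ ∑ k, ∑ j, f ‖x (e k) - x (e j)‖₊ * c (e j) * c (e k) := by
    have h' : (0 : ℂ) ≤ ((∑ k, ∑ j, f ‖x (e k) - x (e j)‖₊ * c (e j) * c (e k) : ℝ) : ℂ) := by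
      push_cast
      simpa using h
    exact_mod_cast h'
  rw [← Equiv.sum_comp e]
  simp_rw [← Equiv.sum_comp e fun j => f ‖x (e _) - x j‖₊ * c j * c (e _)]
  exact h2

/-- The easy half of Bochner's theorem: the form is the integral of `|∑ ξ_j exp(-i⟪x_j, Y⟫)|²`. -/
theorem isRadialPosDef_of_eq_integral {n : ℕ} {f : ℝ≥0 → ℝ} (hf : Continuous f)
    {Ω : Type*} [MeasurableSpace Ω] (μ : Measure Ω) [IsFiniteMeasure μ]
    {Y : Ω → EuclideanSpace ℝ (Fin n)} (hY : Measurable Y)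
    (h : ∀ x, (f ‖x‖₊ : ℂ) = ∫ ω, Complex.exp (⟪x, Y ω⟫ * Complex.I) ∂μ) :
    IsRadialPosDef n f := by
  refine ⟨hf, fun m x ξ => ?_⟩
  have hint : ∀ x, Integrable (fun ω => Complex.exp (⟪x, Y ω⟫ * Complex.I)) μ := by
    intro x
    refine Integrable.of_bound (Measurable.aestronglyMeasurable (by fun_prop)) 1
      (.of_forall fun ω => ?_)
    rw [Complex.norm_exp_ofReal_mul_I]
  simp_rw [h, mul_assoc]
  simp_rw [← integral_mul_const]
  simp_rw [← integral_finsetSum univ fun j _ => (hint (_ - x j)).mul_const _]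
  rw [← integral_finsetSum univ fun k _ =>
    integrable_finsetSum univ fun j _ => (hint (x k - x j)).mul_const _]
  have e : ∀ ω, ∑ k, ∑ j, Complex.exp (⟪x k - x j, Y ω⟫ * Complex.I) * (ξ j * conj (ξ k)) =
      ((Complex.normSq (∑ j, ξ j * Complex.exp (-(⟪x j, Y ω⟫ * Complex.I))) : ℝ) : ℂ) := by
    intro ω
    rw [← Complex.mul_conj, map_sum, sum_mul_sum, sum_comm]
    refine sum_congr rfl fun k _ => sum_congr rfl fun j _ => ?_
    rw [map_mul, ← Complex.exp_conj, inner_sub_left]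
    simp only [map_neg, map_mul, Complex.conj_ofReal, Complex.conj_I, mul_neg, neg_neg]
    rw [Complex.ofReal_sub, sub_mul, sub_eq_add_neg, Complex.exp_add]
    ring
  simp_rw [e]
  rw [integral_complex_ofReal]
  exact_mod_cast integral_nonneg fun ω => Complex.normSq_nonneg _

theorem isRadialPosDef_of_tendsto {n : ℕ} {f : ℝ≥0 → ℝ} (hf : Continuous f)
    {g : ℕ → ℝ≥0 → ℝ} (hg : ∀ N, IsRadialPosDef n (g N))
    (h : ∀ t, Filter.Tendsto (fun N => g N t) Filter.atTop (nhds (f t))) :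
    IsRadialPosDef n f := by
  refine isRadialPosDef_of_real hf fun m x c => ?_
  refine ge_of_tendsto' (tendsto_finsetSum _ fun k _ => tendsto_finsetSum _ fun j _ =>
    ((h _).mul_const _).mul_const _) fun N => (hg N).sum_nonneg x c

theorem IsRadialPosDef.add {n : ℕ} {f g : ℝ≥0 → ℝ} (hf : IsRadialPosDef n f)
    (hg : IsRadialPosDef n g) : IsRadialPosDef n fun t => f t + g t := by
  refine isRadialPosDef_of_real (hf.1.add hg.1) fun m x c => ?_
  refine (add_nonneg (hf.sum_nonneg x c) (hg.sum_nonneg x c)).trans_eq ?_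
  simp only [← sum_add_distrib, add_mul]

theorem IsRadialPosDef.const_mul {n : ℕ} {f : ℝ≥0 → ℝ} (hf : IsRadialPosDef n f) {r : ℝ}
    (hr : 0 ≤ r) : IsRadialPosDef n fun t => r * f t := by
  refine isRadialPosDef_of_real (hf.1.const_mul r) fun m x c => ?_
  refine (mul_nonneg hr (hf.sum_nonneg x c)).trans_eq ?_
  simp only [mul_sum, mul_assoc]

theorem IsRadialPosDef.comp_mul {n : ℕ} {f : ℝ≥0 → ℝ} (hf : IsRadialPosDef n f) (r : ℝ≥0) :
    IsRadialPosDef n fun t => f (r * t) := by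
  refine isRadialPosDef_of_real (hf.1.comp (by fun_prop)) fun m x c => ?_
  convert hf.sum_nonneg (fun k => (r : ℝ) • x k) c using 6
  rw [← smul_sub, nnnorm_smul, NNReal.nnnorm_eq]

/-- Positive definiteness is preserved by the averaging operators
`f ↦ ∫ f(y t) y ^ p dy`. -/
theorem IsRadialPosDef.integral_comp_mul {n : ℕ} {f : ℝ≥0 → ℝ} (hf : IsRadialPosDef n f)
    (p : ℕ) : IsRadialPosDef n fun t => ∫ y in (0 : ℝ)..1, f (y.toNNReal * t) * y ^ p := by
  have hc := hf.1
  refine isRadialPosDef_of_real ?_ fun m x c => ?_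
  · refine intervalIntegral.continuous_parametric_intervalIntegral_of_continuous' (by fun_prop) 0 1
  · have hint : ∀ t, IntervalIntegrable (fun y : ℝ => f (y.toNNReal * t) * y ^ p) volume 0 1 :=
      fun t => Continuous.intervalIntegrable (by fun_prop) 0 1
    simp_rw [mul_assoc, ← intervalIntegral.integral_mul_const]
    simp_rw [← intervalIntegral.integral_finsetSum fun j _ => (hint _).mul_const (_ : ℝ)]
    rw [← intervalIntegral.integral_finsetSum fun k _ =>
      Continuous.intervalIntegrable (by fun_prop) 0 1]
    refine intervalIntegral.integral_nonneg zero_le_one fun y hy => ?_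
    refine (mul_nonneg ((hf.comp_mul y.toNNReal).sum_nonneg x c) (pow_nonneg hy.1 p)).trans_eq ?_
    simp only [sum_mul]
    refine sum_congr rfl fun k _ => sum_congr rfl fun j _ => ?_
    ring

/-! ### The Schoenberg kernel and its products -/

theorem nontrivial_euclideanSpace_fin {n : ℕ} (hn : 1 ≤ n) :
    Nontrivial (EuclideanSpace ℝ (Fin n)) := by
  rw [← Module.finrank_pos_iff (R := ℝ), finrank_euclideanSpace_fin]
  exact hn

theorem schoenbergKernel_abs (n : ℕ) (s : ℝ) : schoenbergKernel n |s| = schoenbergKernel n s := by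
  simp [schoenbergKernel]

theorem schoenbergKernel_norm {n : ℕ} (hn : 1 ≤ n) (x : EuclideanSpace ℝ (Fin n)) :
    (schoenbergKernel n ‖x‖ : ℂ) = ∫ u : sphere (0 : EuclideanSpace ℝ (Fin n)) 1,
      Complex.exp (⟪x, (u : EuclideanSpace ℝ (Fin n))⟫ * Complex.I)
      ∂uniformSphere (EuclideanSpace ℝ (Fin n)) := by
  have := nontrivial_euclideanSpace_fin hn
  rw [integral_cexp_inner_uniformSphere, finrank_euclideanSpace_fin]

theorem schoenbergKernel_mul_norm {n : ℕ} (hn : 1 ≤ n) (a : ℝ) (x : EuclideanSpace ℝ (Fin n)) :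
    (schoenbergKernel n (a * ‖x‖) : ℂ) = ∫ u : sphere (0 : EuclideanSpace ℝ (Fin n)) 1,
      Complex.exp (⟪x, a • (u : EuclideanSpace ℝ (Fin n))⟫ * Complex.I)
      ∂uniformSphere (EuclideanSpace ℝ (Fin n)) := by
  rw [← schoenbergKernel_abs, abs_mul, abs_norm, ← Real.norm_eq_abs, ← norm_smul,
    schoenbergKernel_norm hn]
  simp_rw [real_inner_smul_left, real_inner_smul_right]

theorem exists_norm_eq_one {n : ℕ} (hn : 1 ≤ n) : ∃ w : EuclideanSpace ℝ (Fin n), ‖w‖ = 1 := by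
  have := nontrivial_euclideanSpace_fin hn
  exact exists_norm_eq _ zero_le_one

theorem continuous_schoenbergKernel {n : ℕ} (hn : 1 ≤ n) : Continuous (schoenbergKernel n) := by
  have := nontrivial_euclideanSpace_fin hn
  obtain ⟨w, hw⟩ := exists_norm_eq_one hn
  have h : ∀ s, (schoenbergKernel n s : ℂ) = ∫ u : sphere (0 : EuclideanSpace ℝ (Fin n)) 1,
      Complex.exp (⟪w, s • (u : EuclideanSpace ℝ (Fin n))⟫ * Complex.I)
      ∂uniformSphere (EuclideanSpace ℝ (Fin n)) := fun s => by
    simpa [hw] using schoenbergKernel_mul_norm hn s w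
  have hc : Continuous fun s => (schoenbergKernel n s : ℂ) := by
    simp_rw [h]
    refine continuous_of_dominated (bound := fun _ => 1)
      (fun s => Continuous.aestronglyMeasurable (by fun_prop))
      (fun s => .of_forall fun u => ?_) (integrable_const _) (.of_forall fun u => by fun_prop)
    rw [Complex.norm_exp_ofReal_mul_I]
  exact Complex.continuous_re.comp hc

theorem abs_schoenbergKernel_le_one {n : ℕ} (hn : 1 ≤ n) (s : ℝ) : |schoenbergKernel n s| ≤ 1 := by
  have := nontrivial_euclideanSpace_fin hn
  obtain ⟨w, hw⟩ := exists_norm_eq_one hn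
  have h := schoenbergKernel_mul_norm hn s w
  rw [hw, mul_one] at h
  have h2 := norm_integral_le_of_norm_le_const (μ := uniformSphere (EuclideanSpace ℝ (Fin n)))
    (f := fun u => Complex.exp (⟪w, s • (u : EuclideanSpace ℝ (Fin n))⟫ * Complex.I)) (C := 1)
    (.of_forall fun u => by rw [Complex.norm_exp_ofReal_mul_I])
  rw [← h] at h2
  simpa using h2

theorem schoenbergKernel_isRadialPosDef {n : ℕ} (hn : 1 ≤ n) :
    IsRadialPosDef n fun t => schoenbergKernel n t := by
  have := nontrivial_euclideanSpace_fin hn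
  exact isRadialPosDef_of_eq_integral ((continuous_schoenbergKernel hn).comp (by fun_prop))
    (uniformSphere (EuclideanSpace ℝ (Fin n))) measurable_subtype_coe
    fun x => schoenbergKernel_norm hn x

theorem schoenbergKernel_mul_schoenbergKernel_eq_integral_cexp {n : ℕ} (hn : 1 ≤ n) (a b : ℝ)
    (x : EuclideanSpace ℝ (Fin n)) :
    (schoenbergKernel n (a * ‖x‖) * schoenbergKernel n (b * ‖x‖) : ℂ) =
      ∫ p : sphere (0 : EuclideanSpace ℝ (Fin n)) 1 × sphere (0 : EuclideanSpace ℝ (Fin n)) 1,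
        Complex.exp (⟪x, a • (p.1 : EuclideanSpace ℝ (Fin n)) + b • p.2⟫ * Complex.I)
        ∂(uniformSphere (EuclideanSpace ℝ (Fin n))).prod (uniformSphere _) := by
  have := nontrivial_euclideanSpace_fin hn
  rw [schoenbergKernel_mul_norm hn, schoenbergKernel_mul_norm hn, ← integral_prod_mul]
  refine integral_congr_ae (.of_forall fun p => ?_)
  dsimp only
  rw [← Complex.exp_add, inner_add_right, Complex.ofReal_add, add_mul]

theorem schoenbergKernel_mul_schoenbergKernel_isRadialPosDef {n : ℕ} (hn : 1 ≤ n) (a b : ℝ) :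
    IsRadialPosDef n fun t => schoenbergKernel n (a * t) * schoenbergKernel n (b * t) := by
  have := nontrivial_euclideanSpace_fin hn
  have hc := continuous_schoenbergKernel hn
  refine isRadialPosDef_of_eq_integral (by fun_prop) ((uniformSphere (EuclideanSpace ℝ (Fin n))).prod
    (uniformSphere (EuclideanSpace ℝ (Fin n))))
    (Y := fun p => a • (p.1 : EuclideanSpace ℝ (Fin n)) + b • (p.2 : EuclideanSpace ℝ (Fin n)))
    (Continuous.measurable (by fun_prop)) fun x => ?_
  rw [← schoenbergKernel_mul_schoenbergKernel_eq_integral_cexp hn]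
  push_cast
  rfl

/-- The product formula for the Schoenberg kernel. -/
theorem schoenbergKernel_mul_schoenbergKernel_eq_integral {n : ℕ} (hn : 1 ≤ n) (a b t : ℝ) :
    schoenbergKernel n (a * t) * schoenbergKernel n (b * t) =
      ∫ p : sphere (0 : EuclideanSpace ℝ (Fin n)) 1 × sphere (0 : EuclideanSpace ℝ (Fin n)) 1,
        schoenbergKernel n (t * ‖a • (p.1 : EuclideanSpace ℝ (Fin n)) + b • p.2‖)
        ∂(uniformSphere (EuclideanSpace ℝ (Fin n))).prod (uniformSphere _) := by
  have := nontrivial_euclideanSpace_fin hn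
  set σ := uniformSphere (EuclideanSpace ℝ (Fin n)) with hσ
  -- The left side depends only on the length of the frequency vector, so its direction `w` may be
  -- averaged over the sphere. After exchanging the integrals, the one over `w` is again a
  -- Schoenberg kernel.
  have h1 : ∀ w : sphere (0 : EuclideanSpace ℝ (Fin n)) 1,
      (schoenbergKernel n (a * t) * schoenbergKernel n (b * t) : ℂ) =
      ∫ p : sphere (0 : EuclideanSpace ℝ (Fin n)) 1 × sphere (0 : EuclideanSpace ℝ (Fin n)) 1,
        Complex.exp (⟪t • (w : EuclideanSpace ℝ (Fin n)),
          a • (p.1 : EuclideanSpace ℝ (Fin n)) + b • p.2⟫ * Complex.I) ∂σ.prod σ := by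
    intro w
    rw [← schoenbergKernel_mul_schoenbergKernel_eq_integral_cexp hn, norm_smul,
      norm_eq_of_mem_sphere, mul_one, Real.norm_eq_abs, ← schoenbergKernel_abs n (a * t),
      ← schoenbergKernel_abs n (b * t), ← schoenbergKernel_abs n (a * |t|),
      ← schoenbergKernel_abs n (b * |t|)]
    simp only [abs_mul, abs_abs]
  have h2 : (schoenbergKernel n (a * t) * schoenbergKernel n (b * t) : ℂ) =
      ∫ _w, (schoenbergKernel n (a * t) * schoenbergKernel n (b * t) : ℂ) ∂σ := by
    simp
  have h3 : (schoenbergKernel n (a * t) * schoenbergKernel n (b * t) : ℂ) =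
      ∫ p : sphere (0 : EuclideanSpace ℝ (Fin n)) 1 × sphere (0 : EuclideanSpace ℝ (Fin n)) 1,
        (schoenbergKernel n (t * ‖a • (p.1 : EuclideanSpace ℝ (Fin n)) + b • p.2‖) : ℂ)
        ∂σ.prod σ := by
    rw [h2, integral_congr_ae (.of_forall h1), integral_integral_swap]
    · refine integral_congr_ae (.of_forall fun p => ?_)
      dsimp only
      rw [schoenbergKernel_mul_norm hn]
      refine integral_congr_ae (.of_forall fun w => ?_)
      dsimp only
      rw [real_inner_smul_left, real_inner_smul_right, real_inner_comm]
    · refine Integrable.of_bound (Continuous.aestronglyMeasurable (by fun_prop)) 1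
        (.of_forall fun ω => ?_)
      simp only [Function.uncurry]
      rw [Complex.norm_exp_ofReal_mul_I]
  rw [integral_complex_ofReal] at h3
  exact_mod_cast h3

/-! ### Gaussian means of radial positive definite functions -/

theorem map_smul_sub_smul_stdGaussian {E : Type*} [NormedAddCommGroup E] [InnerProductSpace ℝ E]
    [FiniteDimensional ℝ E] [MeasurableSpace E] [BorelSpace E] {r q R : ℝ}
    (h : R ^ 2 = r ^ 2 + q ^ 2) :
    ((stdGaussian E).prod (stdGaussian E)).map (fun p => r • p.1 - q • p.2) =
      (stdGaussian E).map fun x => R • x := by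
  have : IsProbabilityMeasure (((stdGaussian E).prod (stdGaussian E)).map
    (fun p => r • p.1 - q • p.2)) := Measure.isProbabilityMeasure_map (by fun_prop)
  have : IsProbabilityMeasure ((stdGaussian E).map fun x => R • x) :=
    Measure.isProbabilityMeasure_map (by fun_prop)
  refine Measure.ext_of_charFun (funext fun t => ?_)
  rw [charFun_map_smul, charFun_stdGaussian, charFun_apply, integral_map (by fun_prop)
    (by fun_prop)]
  have e : ∀ p : E × E, Complex.exp (⟪r • p.1 - q • p.2, t⟫ * Complex.I) =
      Complex.exp (⟪p.1, r • t⟫ * Complex.I) * Complex.exp (⟪p.2, (-q) • t⟫ * Complex.I) := by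
    intro p
    rw [← Complex.exp_add, ← add_mul, ← Complex.ofReal_add, inner_sub_left, real_inner_smul_left,
      real_inner_smul_left, real_inner_smul_right, real_inner_smul_right]
    congr 3
    ring
  simp_rw [e]
  rw [integral_prod_mul (fun x : E => Complex.exp (⟪x, r • t⟫ * Complex.I))
    fun x : E => Complex.exp (⟪x, (-q) • t⟫ * Complex.I), ← charFun_apply, ← charFun_apply,
    charFun_stdGaussian, charFun_stdGaussian, ← Complex.exp_add]
  congr 1
  simp only [norm_smul, norm_neg, Real.norm_eq_abs]
  norm_cast
  simp only [mul_pow, sq_abs]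
  rw [h]
  ring

/-- The mean of the radial function `f(|x|)` on `ℝᵐ` with respect to the centred Gaussian measure
of variance `s`. -/
def gaussianMean (m : ℕ) (f : ℝ≥0 → ℝ) (s : ℝ≥0) : ℝ :=
  ∫ x, f (NNReal.sqrt s * ‖x‖₊) ∂stdGaussian (EuclideanSpace ℝ (Fin m))

/-- Divide by `N²` and let `N` grow: the linear term is negligible. -/
theorem nonneg_of_forall_nat_sq_mul_add {Q D : ℝ} (h : ∀ N : ℕ, 0 ≤ (N : ℝ) ^ 2 * Q + N * D) :
    0 ≤ Q := by
  by_contra! hQ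
  obtain ⟨N, hN⟩ := exists_nat_gt (|D| / -Q)
  rw [div_lt_iff₀ (by linarith)] at hN
  have hN0 : (0 : ℝ) < N := by
    rcases Nat.eq_zero_or_pos N with rfl | h0
    · have := abs_nonneg D
      simp at hN
      linarith
    · exact_mod_cast h0
  have h1 := h N
  have h2 : (N : ℝ) * Q + D < 0 := by linarith [le_abs_self D]
  nlinarith

theorem integral_comp_pair {E : Type} [MeasurableSpace E]
    {Ω : Type*} [MeasurableSpace Ω] {P : Measure Ω} [IsProbabilityMeasure P] {μ : Measure E}
    [IsProbabilityMeasure μ] {X Y : Ω → E} (hX : Measurable X) (hY : Measurable Y)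
    (hX' : P.map X = μ) (hY' : P.map Y = μ) (hXY : IndepFun X Y P) {g : E × E → ℝ}
    (hg : Measurable g) : ∫ ω, g (X ω, Y ω) ∂P = ∫ p, g p ∂μ.prod μ := by
  rw [indepFun_iff_map_prod_eq_prod_map_map hX.aemeasurable hY.aemeasurable, hX', hY'] at hXY
  rw [← hXY, integral_map (by fun_prop) hg.aestronglyMeasurable]

/-- The Gaussian means of a radial positive definite function form a positive definite function
on the additive semigroup of the variances. -/
theorem IsRadialPosDef.sum_gaussianMean_nonneg {m : ℕ} {f : ℝ≥0 → ℝ} (hf : IsRadialPosDef m f)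
    {C : ℝ} (hC : ∀ t, |f t| ≤ C) {p : ℕ} (s : Fin p → ℝ≥0) (c : Fin p → ℝ) :
    0 ≤ ∑ i, ∑ j, gaussianMean m f (s i + s j) * c j * c i := by
  have hfc := hf.1
  set γ := stdGaussian (EuclideanSpace ℝ (Fin m))
  -- For each `i` take `N` independent Gaussian points of variance `s i`, all with weight `c i`, and
  -- average the form of `f`. The difference of two distinct points has variance `s i + s j`, which
  -- yields `N²` times the wanted form; each point paired with itself gives `f 0` instead, and `N *
  -- D` corrects for this.
  refine nonneg_of_forall_nat_sq_mul_add
    (D := ∑ i, (f 0 - gaussianMean m f (s i + s i)) * c i * c i) fun N => ?_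
  obtain ⟨Ω, _, P, X, hXm, hXlaw, hXind, _⟩ := exists_iid (Fin p × Fin N) γ
  have hpair : ∀ α β : Fin p × Fin N, ∫ ω, f ‖(NNReal.sqrt (s α.1) : ℝ) • X α ω -
      (NNReal.sqrt (s β.1) : ℝ) • X β ω‖₊ ∂P = gaussianMean m f (s α.1 + s β.1) +
        if α = β then f 0 - gaussianMean m f (s α.1 + s α.1) else 0 := by
    intro α β
    split_ifs with h
    · subst h
      simp
    · rw [integral_comp_pair (hXm α) (hXm β) (hXlaw α).map_eq (hXlaw β).map_eq
        (hXind.indepFun h) (g := fun q => f ‖(NNReal.sqrt (s α.1) : ℝ) • q.1 -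
        (NNReal.sqrt (s β.1) : ℝ) • q.2‖₊) (by fun_prop)]
      have h1 := map_smul_sub_smul_stdGaussian (E := EuclideanSpace ℝ (Fin m))
        (r := NNReal.sqrt (s α.1)) (q := NNReal.sqrt (s β.1))
        (R := NNReal.sqrt (s α.1 + s β.1)) (by
          rw [← NNReal.coe_pow, ← NNReal.coe_pow, ← NNReal.coe_pow, NNReal.sq_sqrt,
            NNReal.sq_sqrt, NNReal.sq_sqrt, NNReal.coe_add])
      have h2 : ∫ z, f ‖z‖₊ ∂(γ.prod γ).map (fun q => (NNReal.sqrt (s α.1) : ℝ) • q.1 -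
          (NNReal.sqrt (s β.1) : ℝ) • q.2) = ∫ z, f ‖z‖₊
          ∂γ.map fun x => (NNReal.sqrt (s α.1 + s β.1) : ℝ) • x := by
        rw [h1]
      rw [integral_map (by fun_prop) (by fun_prop), integral_map (by fun_prop) (by fun_prop)] at h2
      rw [h2, gaussianMean, add_zero]
      refine integral_congr_ae (.of_forall fun x => ?_)
      simp only [nnnorm_smul, NNReal.nnnorm_eq]
  have hint : ∀ α β : Fin p × Fin N, Integrable (fun ω => f ‖(NNReal.sqrt (s α.1) : ℝ) • X α ω -
      (NNReal.sqrt (s β.1) : ℝ) • X β ω‖₊) P := fun α β =>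
    Integrable.of_bound (Measurable.aestronglyMeasurable (by fun_prop)) C
      (.of_forall fun ω => hC _)
  have hpos : 0 ≤ ∫ ω, ∑ α : Fin p × Fin N, ∑ β : Fin p × Fin N,
      f ‖(NNReal.sqrt (s α.1) : ℝ) • X α ω -
      (NNReal.sqrt (s β.1) : ℝ) • X β ω‖₊ * c β.1 * c α.1 ∂P :=
    integral_nonneg fun ω => hf.sum_nonneg (fun α : Fin p × Fin N =>
      (NNReal.sqrt (s α.1) : ℝ) • X α ω) fun α => c α.1
  rw [integral_finsetSum _ fun α _ => integrable_finsetSum _ fun β _ =>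
    ((hint α β).mul_const _).mul_const _] at hpos
  simp_rw [integral_finsetSum univ fun β _ => ((hint _ β).mul_const _).mul_const _,
    integral_mul_const, hpair, add_mul, ite_mul, zero_mul, sum_add_distrib, sum_ite_eq,
    mem_univ, if_true, Fintype.sum_prod_type, sum_const, card_univ, Fintype.card_fin,
    nsmul_eq_mul, ← mul_sum] at hpos
  rw [sq, mul_assoc]
  exact hpos

theorem IsRadialPosDef.gaussianMean_nonneg {m : ℕ} {f : ℝ≥0 → ℝ} (hf : IsRadialPosDef m f)
    {C : ℝ} (hC : ∀ t, |f t| ≤ C) (s : ℝ≥0) : 0 ≤ gaussianMean m f s := by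
  have h := hf.sum_gaussianMean_nonneg hC (p := 1) (fun _ => s / 2) fun _ => 1
  simpa using h

/-- Gaussian means of a function with an entire power series, computed termwise. -/
theorem hasSum_gaussianMean {m : ℕ} (hm : 1 ≤ m) {f : ℝ≥0 → ℝ} {e : ℕ → ℝ}
    (hf : ∀ t : ℝ≥0, HasSum (fun k => e k * (t : ℝ) ^ (2 * k)) (f t)) (s : ℝ≥0)
    (he : Summable fun k => |e k| * (2 * s) ^ k * risingFactorial (m / 2) k) :
    HasSum (fun k => e k * (2 * s) ^ k * risingFactorial (m / 2) k) (gaussianMean m f s) := by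
  have := nontrivial_euclideanSpace_fin hm
  have hm0 : (0 : ℝ) < m / 2 := by positivity
  have hpow : ∀ (x : EuclideanSpace ℝ (Fin m)) (k : ℕ),
      ((NNReal.sqrt s * ‖x‖₊ : ℝ≥0) : ℝ) ^ (2 * k) = (s : ℝ) ^ k * ‖x‖ ^ (2 * k) := by
    intro x k
    push_cast
    rw [mul_pow, pow_mul (Real.sqrt s), Real.sq_sqrt (NNReal.coe_nonneg s)]
  have hint : ∀ k, Integrable (fun x : EuclideanSpace ℝ (Fin m) =>
      e k * ((s : ℝ) ^ k * ‖x‖ ^ (2 * k))) (stdGaussian (EuclideanSpace ℝ (Fin m))) :=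
    fun k => ((integrable_norm_pow_stdGaussian (2 * k)).const_mul _).const_mul _
  have hval : ∀ (a : ℝ) (k : ℕ), ∫ x : EuclideanSpace ℝ (Fin m),
      a * ((s : ℝ) ^ k * ‖x‖ ^ (2 * k)) ∂stdGaussian (EuclideanSpace ℝ (Fin m)) =
      a * (2 * s) ^ k * risingFactorial (m / 2) k := by
    intro a k
    rw [integral_const_mul, integral_const_mul, integral_norm_pow_stdGaussian,
      finrank_euclideanSpace_fin, mul_pow]
    ring
  have h := hasSum_integral_of_summable_integral_norm hint (by
    have e1 : ∀ (k : ℕ) (x : EuclideanSpace ℝ (Fin m)), ‖e k * ((s : ℝ) ^ k * ‖x‖ ^ (2 * k))‖ =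
        |e k| * ((s : ℝ) ^ k * ‖x‖ ^ (2 * k)) := by
      intro k x
      rw [norm_mul, Real.norm_eq_abs, Real.norm_of_nonneg (by positivity)]
    simp_rw [e1, hval]
    exact he)
  simp_rw [hval] at h
  convert! h using 1
  refine integral_congr_ae (.of_forall fun x => ?_)
  have h2 := hf (NNReal.sqrt s * ‖x‖₊)
  simp_rw [hpow] at h2
  exact h2.tsum_eq.symm

/-! ### Products of Schoenberg kernels in the next dimension -/

/-- Here `T` is `₁F₁(-1/2; ν; z)`. Its terms beyond the linear one are nonpositive, whence the bound
by its first two terms; the Cauchy product with the series of `e^{-z}` gives the sum. -/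
theorem hasSum_kummer_half {ν : ℝ} (hν : 1 / 2 ≤ ν) {z : ℝ} (hz : 0 ≤ z) :
    ∃ T : ℝ, T ≤ 1 - z / (2 * ν) ∧
      HasSum (fun k : ℕ => (-z) ^ k * (risingFactorial (ν + 1 / 2) k /
        (k.factorial * risingFactorial ν k))) (T * Real.exp (-z)) := by
  have hν0 : 0 < ν := by linarith
  set F : ℕ → ℝ := fun i => (-z) ^ i * (fallingFactorial (1 / 2) i /
    (i.factorial * risingFactorial ν i)) with hF
  have hFs : Summable fun i => ‖F i‖ := by
    refine Summable.of_nonneg_of_le (fun _ => norm_nonneg _) (fun i => ?_)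
      (Real.summable_pow_div_factorial z)
    have h1 := risingFactorial_pos hν0 i
    have h2 := (abs_fallingFactorial_half_le i).trans
      (risingFactorial_mono (by norm_num : (0 : ℝ) ≤ 1 / 2) hν i)
    rw [hF, norm_mul, norm_pow, norm_neg, Real.norm_of_nonneg hz, norm_div, Real.norm_eq_abs,
      Real.norm_of_nonneg (by positivity : (0 : ℝ) ≤ i.factorial * risingFactorial ν i),
      div_eq_mul_inv (z ^ i)]
    gcongr
    rw [div_le_iff₀ (by positivity)]
    have : ((i.factorial : ℝ)⁻¹) * (i.factorial * risingFactorial ν i) = risingFactorial ν i := by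
      field_simp
    rw [this]
    exact h2
  have hEs : Summable fun j : ℕ => ‖(-z) ^ j / (j.factorial : ℝ)‖ :=
    (Real.summable_pow_div_factorial (-z)).norm
  refine ⟨∑' i, F i, ?_, ?_⟩
  · have h0 : ∑' i, F i = F 0 + (F 1 + ∑' i, F (i + 2)) := by
      rw [hFs.of_norm.tsum_eq_zero_add, ((summable_nat_add_iff 1).2 hFs.of_norm).tsum_eq_zero_add]
    have h1 : ∑' i, F (i + 2) ≤ 0 := by
      refine tsum_nonpos fun i => ?_
      have h2 := neg_one_pow_mul_fallingFactorial_half_nonpos (i + 1)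
      have h3 := risingFactorial_pos hν0 (i + 2)
      have : F (i + 2) = ((-1) ^ (i + 1 + 1) * fallingFactorial (1 / 2) (i + 1 + 1)) *
          (z ^ (i + 2) / ((i + 2).factorial * risingFactorial ν (i + 2))) := by
        simp only [hF]
        rw [neg_pow z]
        ring
      rw [this]
      exact mul_nonpos_of_nonpos_of_nonneg h2 (by positivity)
    have h2 : F 0 = 1 := by simp [hF]
    have h3 : F 1 = -(z / (2 * ν)) := by
      simp [hF, fallingFactorial, risingFactorial]
      field_simp
    rw [h0, h2, h3]
    linarith
  · have h1 := summable_norm_sum_mul_antidiagonal_of_summable_norm hFs hEs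
    have h2 := tsum_mul_tsum_eq_tsum_sum_antidiagonal_of_summable_norm hFs hEs
    rw [Real.exp_eq_exp_ℝ, NormedSpace.exp_eq_tsum_div]
    dsimp only
    rw [h2]
    refine HasSum.congr_fun h1.of_norm.hasSum fun k => ?_
    rw [← sum_antidiagonal_kummer hν0, mul_sum]
    refine sum_congr rfl fun ij hij => ?_
    rw [← HasAntidiagonal.mem_antidiagonal.1 hij, pow_add, hF]
    ring

/-- Kummer's transformation with `ν = n/2` and `z = r² s / 2`: the bound `1 - z/(2ν)` is `1 - r²
s/(2n)`. -/
theorem gaussianMean_schoenbergKernel_neg {n : ℕ} (hn : 1 ≤ n) {r : ℝ} {s : ℝ≥0}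
    (h : 2 * n < r ^ 2 * s) :
    gaussianMean (n + 1) (fun t => schoenbergKernel n (r * t)) s < 0 := by
  have hν : (1 / 2 : ℝ) ≤ n / 2 := by
    have : (1 : ℝ) ≤ n := by exact_mod_cast hn
    linarith
  have hν0 : (0 : ℝ) < n / 2 := by linarith
  have hz : 0 ≤ r ^ 2 * s / 2 := by positivity
  have hdim : ((n + 1 : ℕ) : ℝ) / 2 = n / 2 + 1 / 2 := by push_cast; ring
  obtain ⟨T, hT, hsum⟩ := hasSum_kummer_half hν hz
  have hk : ∀ k : ℕ, (-(r ^ 2 / 4)) ^ k / (k.factorial * risingFactorial (n / 2) k) *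
      (2 * (s : ℝ)) ^ k * risingFactorial ((n + 1 : ℕ) / 2) k = (-(r ^ 2 * s / 2)) ^ k *
      (risingFactorial (n / 2 + 1 / 2) k / (k.factorial * risingFactorial (n / 2) k)) := by
    intro k
    rw [hdim, show -(r ^ 2 * (s : ℝ) / 2) = -(r ^ 2 / 4) * (2 * s) by ring,
      mul_pow (-(r ^ 2 / 4)), div_mul_eq_mul_div, div_mul_eq_mul_div, mul_div_assoc]
  have hG := hasSum_gaussianMean (m := n + 1) (by omega)
    (f := fun t => schoenbergKernel n (r * t))
    (e := fun k => (-(r ^ 2 / 4)) ^ k / (k.factorial * risingFactorial (n / 2) k))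
    (fun t => by
      refine HasSum.congr_fun (hasSum_schoenbergKernel hn (r * t)) fun k => ?_
      rw [show -((r * (t : ℝ)) ^ 2 / 4) = -(r ^ 2 / 4) * t ^ 2 by ring, mul_pow, ← pow_mul]
      ring) s (by
      refine Summable.of_nonneg_of_le (fun k => ?_) (fun k => ?_)
        (Real.summable_pow_div_factorial (r ^ 2 * s))
      · have := risingFactorial_pos (by positivity : (0 : ℝ) < ((n + 1 : ℕ) : ℝ) / 2) k
        positivity
      · have h1 := risingFactorial_pos hν0 k
        have h2 := risingFactorial_add_half_le hν k
        rw [hdim, abs_div, abs_pow, abs_neg, abs_of_nonneg (by positivity : 0 ≤ r ^ 2 / 4),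
          abs_of_pos (by positivity : (0 : ℝ) < k.factorial * risingFactorial (n / 2) k)]
        calc (r ^ 2 / 4) ^ k / (k.factorial * risingFactorial (n / 2) k) * (2 * (s : ℝ)) ^ k *
              risingFactorial (n / 2 + 1 / 2) k
            ≤ (r ^ 2 / 4) ^ k / (k.factorial * risingFactorial (n / 2) k) * (2 * (s : ℝ)) ^ k *
              (2 ^ k * risingFactorial (n / 2) k) := by gcongr
          _ = (r ^ 2 / 4 * (2 * s) * 2) ^ k / k.factorial := by
              rw [mul_pow _ (2 : ℝ), mul_pow (r ^ 2 / 4)]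
              field_simp
          _ = _ := by congr 2; ring)
  simp_rw [hk] at hG
  rw [hG.unique hsum]
  refine mul_neg_of_neg_of_pos (hT.trans_lt ?_) (Real.exp_pos _)
  rw [sub_neg, lt_div_iff₀ (by linarith)]
  linarith

theorem abs_sub_le_norm_smul_add_smul {E : Type*} [NormedAddCommGroup E] [NormedSpace ℝ E]
    {a b : ℝ} (ha : 0 ≤ a) (hb : 0 ≤ b) {u v : E} (hu : ‖u‖ = 1) (hv : ‖v‖ = 1) :
    |a - b| ≤ ‖a • u + b • v‖ := by
  have h := abs_norm_sub_norm_le (a • u) (-(b • v))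
  rw [norm_neg, norm_smul, norm_smul, hu, hv, Real.norm_of_nonneg ha, Real.norm_of_nonneg hb,
    mul_one, mul_one, sub_neg_eq_add] at h
  exact h

theorem not_isRadialPosDef_schoenbergKernel_mul_schoenbergKernel {n : ℕ} (hn : 1 ≤ n) {a b : ℝ}
    (ha : 0 ≤ a) (hb : 0 ≤ b) (hab : a ≠ b) :
    ¬ IsRadialPosDef (n + 1) fun t => schoenbergKernel n (a * t) * schoenbergKernel n (b * t) := by
  intro hpd
  have := nontrivial_euclideanSpace_fin hn
  set σ := uniformSphere (EuclideanSpace ℝ (Fin n)) with hσ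
  set γ := stdGaussian (EuclideanSpace ℝ (Fin (n + 1))) with hγ
  have hc := continuous_schoenbergKernel hn
  have hd : 0 < (a - b) ^ 2 := by
    have := sub_ne_zero.2 hab
    positivity
  -- Since `|a u + b v| ≥ |a - b|` for all unit `u`, `v`, this single variance makes the Gaussian
  -- mean negative for every pair.
  obtain ⟨s, hs⟩ : ∃ s : ℝ≥0, 2 * n < (a - b) ^ 2 * s := by
    refine ⟨((2 * n + 1) / (a - b) ^ 2).toNNReal, ?_⟩
    rw [Real.coe_toNNReal _ (by positivity), mul_div_cancel₀ _ hd.ne']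
    linarith
  have h0 := hpd.gaussianMean_nonneg (C := 1) (fun t => by
    rw [abs_mul]
    exact mul_le_one₀ (abs_schoenbergKernel_le_one hn _) (abs_nonneg _)
      (abs_schoenbergKernel_le_one hn _)) s
  let Y : sphere (0 : EuclideanSpace ℝ (Fin n)) 1 × sphere (0 : EuclideanSpace ℝ (Fin n)) 1 → ℝ :=
    fun p => ‖a • (p.1 : EuclideanSpace ℝ (Fin n)) + b • (p.2 : EuclideanSpace ℝ (Fin n))‖
  have hY : Continuous Y := by fun_prop
  have hint : Integrable (Function.uncurry fun (x : EuclideanSpace ℝ (Fin (n + 1))) p =>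
      schoenbergKernel n ((NNReal.sqrt s * ‖x‖₊ : ℝ≥0) * Y p)) (γ.prod (σ.prod σ)) :=
    Integrable.of_bound (Continuous.aestronglyMeasurable (by
      unfold Function.uncurry
      fun_prop)) 1 (.of_forall fun q => abs_schoenbergKernel_le_one hn _)
  have h1 : gaussianMean (n + 1) (fun t => schoenbergKernel n (a * t) * schoenbergKernel n (b * t)) s
      = ∫ p, gaussianMean (n + 1) (fun t => schoenbergKernel n (Y p * t)) s ∂σ.prod σ := by
    unfold gaussianMean
    simp_rw [schoenbergKernel_mul_schoenbergKernel_eq_integral hn]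
    rw [integral_integral_swap hint]
    simp_rw [mul_comm]
    rfl
  have hneg : ∀ p, gaussianMean (n + 1) (fun t => schoenbergKernel n (Y p * t)) s < 0 := by
    intro p
    refine gaussianMean_schoenbergKernel_neg hn (hs.trans_le ?_)
    gcongr ?_ * _
    rw [← sq_abs (a - b)]
    gcongr
    exact abs_sub_le_norm_smul_add_smul ha hb (norm_eq_of_mem_sphere _) (norm_eq_of_mem_sphere _)
  have hint2 : Integrable (fun p => gaussianMean (n + 1) (fun t => schoenbergKernel n (Y p * t)) s)
      (σ.prod σ) := by
    have := hint.integral_prod_right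
    refine this.congr (.of_forall fun p => ?_)
    simp only [Function.uncurry, gaussianMean]
    simp_rw [mul_comm]
    rfl
  rw [h1] at h0
  have h2 : 0 ≤ ∫ p, -gaussianMean (n + 1) (fun t => schoenbergKernel n (Y p * t)) s ∂σ.prod σ :=
    integral_nonneg fun p => by
      have := hneg p
      simp only [Pi.zero_apply]
      linarith
  -- Both signs hold, so the integral is zero; a strictly negative function cannot integrate to zero
  -- against a probability measure.
  have h3 : ∫ p, -gaussianMean (n + 1) (fun t => schoenbergKernel n (Y p * t)) s ∂σ.prod σ = 0 := by
    rw [integral_neg] at h2 ⊢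
    linarith
  rw [integral_eq_zero_iff_of_nonneg (fun p => by
    have := hneg p
    simp only [Pi.zero_apply]
    linarith) hint2.fun_neg] at h3
  obtain ⟨p, hp⟩ := h3.exists
  have := hneg p
  simp only [Pi.zero_apply] at hp
  linarith

/-! ### Positive definite power series on a half-line -/

/-- The value at `0` of the `k`-th forward difference of `x ↦ x ^ l`. -/
def fwdDiffPow (k l : ℕ) : ℝ :=
  ∑ a ∈ range (k + 1), ((-1 : ℝ) ^ (k - a) * k.choose a) * (a : ℝ) ^ l

theorem fwdDiffPow_eq (k l : ℕ) : fwdDiffPow k l = (fwdDiff 1)^[k] (fun r : ℝ => r ^ l) 0 := by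
  rw [fwdDiff_iter_eq_sum_shift]
  simp [fwdDiffPow]

theorem fwdDiffPow_of_lt {k l : ℕ} (h : l < k) : fwdDiffPow k l = 0 := by
  rw [fwdDiffPow_eq, fwdDiff_iter_pow_eq_zero_of_lt h, Pi.zero_apply]

theorem fwdDiffPow_self (k : ℕ) : fwdDiffPow k k = k.factorial := by
  rw [fwdDiffPow_eq, fwdDiff_iter_eq_factorial]
  simp

theorem abs_fwdDiffPow_le (k l : ℕ) : |fwdDiffPow k l| ≤ 2 ^ k * (k : ℝ) ^ l := by
  calc |fwdDiffPow k l| ≤ ∑ a ∈ range (k + 1), (k.choose a : ℝ) * (k : ℝ) ^ l := by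
        refine (abs_sum_le_sum_abs _ _).trans (sum_le_sum fun a ha => ?_)
        rw [abs_mul, abs_mul, abs_pow, abs_neg, abs_one, one_pow, one_mul, Nat.abs_cast, abs_pow,
          Nat.abs_cast]
        gcongr
        exact Nat.lt_succ_iff.1 (mem_range.1 ha)
    _ = _ := by
        rw [← sum_mul]
        congr 1
        exact_mod_cast Nat.sum_range_choose k

theorem hasSum_fwdDiff_iter {G : ℝ≥0 → ℝ} {g : ℕ → ℝ}
    (hG : ∀ s : ℝ≥0, HasSum (fun l => g l * (s : ℝ) ^ l) (G s)) (k : ℕ) (h : ℝ≥0) :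
    HasSum (fun l => g l * (h : ℝ) ^ l * fwdDiffPow k l) ((fwdDiff h)^[k] G 0) := by
  rw [fwdDiff_iter_eq_sum_shift]
  have := hasSum_sum (s := range (k + 1)) fun a _ =>
    (hG (0 + a • h)).mul_left ((-1 : ℝ) ^ (k - a) * k.choose a)
  convert! this using 1
  · funext l
    rw [fwdDiffPow, mul_sum]
    refine sum_congr rfl fun a _ => ?_
    simp only [zero_add, nsmul_eq_mul, NNReal.coe_mul, NNReal.coe_natCast, mul_pow]
    ring
  · refine sum_congr rfl fun a _ => ?_
    simp

/-- Difference quotients converge to the `k`-th derivative: the `k`-th difference kills powers below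
`k`, gives `k!` at `k`, and leaves a factor `h ^ (l - k)` above. As `h ≤ 1`, the terms are dominated
by `2 ^ k` times those of `G` at the point `k`. -/
theorem tendsto_fwdDiff_iter_div_pow {G : ℝ≥0 → ℝ} {g : ℕ → ℝ}
    (hG : ∀ s : ℝ≥0, HasSum (fun l => g l * (s : ℝ) ^ l) (G s)) (k : ℕ) :
    Filter.Tendsto (fun N : ℕ => (fwdDiff (1 / ((N : ℝ≥0) + 1)))^[k] G 0 / (1 / ((N : ℝ) + 1)) ^ k)
      Filter.atTop (nhds (k.factorial * g k)) := by
  have h0 : Filter.Tendsto (fun N : ℕ => 1 / ((N : ℝ) + 1)) Filter.atTop (nhds 0) :=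
    tendsto_one_div_add_atTop_nhds_zero_nat
  have hterm : ∀ N : ℕ, (fwdDiff (1 / ((N : ℝ≥0) + 1)))^[k] G 0 / (1 / ((N : ℝ) + 1)) ^ k =
      ∑' l, if l < k then 0 else g l * (1 / ((N : ℝ) + 1)) ^ (l - k) * fwdDiffPow k l := by
    intro N
    have h1 := (hasSum_fwdDiff_iter hG k (1 / ((N : ℝ≥0) + 1))).div_const ((1 / ((N : ℝ) + 1)) ^ k)
    rw [← h1.tsum_eq]
    refine tsum_congr fun l => ?_
    split_ifs with hl
    · simp [fwdDiffPow_of_lt hl]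
    · have hN : (1 / ((N : ℝ) + 1)) ≠ 0 := by positivity
      push_cast
      rw [← Nat.sub_add_cancel (not_lt.1 hl), pow_add, Nat.add_sub_cancel]
      field_simp
  simp_rw [hterm]
  have hlim : ∑' l, (if l = k then k.factorial * g k else 0) = k.factorial * g k := tsum_ite_eq k _
  rw [← hlim]
  refine tendsto_tsum_of_dominated_convergence (bound := fun l => 2 ^ k * |g l * (k : ℝ) ^ l|)
    ((hG k).summable.abs.mul_left _) (fun l => ?_) (.of_forall fun N l => ?_)
  · rcases lt_trichotomy l k with hl | hl | hl
    · simp [hl, hl.ne]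
    · subst hl
      simp [fwdDiffPow_self, mul_comm]
    · simp only [hl.not_gt, hl.ne', if_false]
      have h2 := ((h0.pow (l - k)).const_mul (g l)).mul_const (fwdDiffPow k l)
      rwa [zero_pow (by omega), mul_zero, zero_mul] at h2
  · split_ifs with hl
    · simp
      positivity
    · rw [norm_mul, norm_mul, norm_pow, Real.norm_eq_abs, Real.norm_eq_abs, Real.norm_eq_abs,
        abs_mul, abs_pow, Nat.abs_cast]
      have h1 : |1 / ((N : ℝ) + 1)| ^ (l - k) ≤ 1 := by
        refine pow_le_one₀ (abs_nonneg _) ?_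
        rw [abs_of_pos (by positivity), div_le_one (by positivity)]
        linarith [(N.cast_nonneg : (0 : ℝ) ≤ N)]
      calc |g l| * |1 / ((N : ℝ) + 1)| ^ (l - k) * |fwdDiffPow k l|
          ≤ |g l| * 1 * (2 ^ k * (k : ℝ) ^ l) := by
            gcongr
            exact abs_fwdDiffPow_le k l
        _ = _ := by ring

/-- Both sums are padded to a common length `p` by vanishing binomial coefficients, so that
differences of orders `i` and `j` live on the same nodes `a * h`. -/
theorem fwdDiff_iter_add_eq_sum (G : ℝ≥0 → ℝ) (h : ℝ≥0) {i j p : ℕ} (hi : i < p) (hj : j < p) :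
    (fwdDiff h)^[i + j] G 0 = ∑ a : Fin p, ∑ b : Fin p, G (a * h + b * h) *
      ((-1) ^ (j - (b : ℕ)) * j.choose b) * ((-1) ^ (i - (a : ℕ)) * i.choose a) := by
  have hext : ∀ {k : ℕ} (_ : k < p) (F : ℕ → ℝ),
      ∑ a ∈ range (k + 1), ((-1 : ℝ) ^ (k - a) * k.choose a) * F a =
        ∑ a : Fin p, ((-1 : ℝ) ^ (k - (a : ℕ)) * k.choose a) * F a := by
    intro k hk F
    rw [Fin.sum_univ_eq_sum_range (fun a => ((-1 : ℝ) ^ (k - a) * k.choose a) * F a)]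
    refine sum_subset (range_subset_range.2 hk) fun a _ ha => ?_
    rw [Nat.choose_eq_zero_of_lt (by simpa using ha)]
    simp
  have hshift : ∀ (F : ℝ≥0 → ℝ) (k : ℕ) (y : ℝ≥0), (fwdDiff h)^[k] F y =
      ∑ a ∈ range (k + 1), ((-1 : ℝ) ^ (k - a) * k.choose a) * F (y + a * h) := by
    intro F k y
    rw [fwdDiff_iter_eq_sum_shift]
    simp
  rw [Function.iterate_add_apply, hshift, hext hi fun a => (fwdDiff h)^[j] G (0 + a * h)]
  refine sum_congr rfl fun a _ => ?_
  rw [hshift, hext hj fun b => G (0 + (a : ℕ) * h + b * h), mul_sum]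
  refine sum_congr rfl fun b _ => ?_
  rw [zero_add]
  ring

/-- If `s, t ↦ G (s + t)` is a positive definite kernel and `G` is given by an everywhere
convergent power series, then the derivatives of `G` at `0` form a positive definite
Hankel matrix. -/
theorem hankel_sq_le_of_posDef {G : ℝ≥0 → ℝ} {g : ℕ → ℝ}
    (hG : ∀ s : ℝ≥0, HasSum (fun l => g l * (s : ℝ) ^ l) (G s))
    (hpos : ∀ (p : ℕ) (s : Fin p → ℝ≥0) (c : Fin p → ℝ),
      0 ≤ ∑ i, ∑ j, G (s i + s j) * c j * c i) (i j : ℕ) :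
    ((i + j).factorial * g (i + j)) ^ 2 ≤
      ((i + i).factorial * g (i + i)) * ((j + j).factorial * g (j + j)) := by
  have key : ∀ x y : ℝ, 0 ≤ ((i + i).factorial * g (i + i)) * x ^ 2 +
      2 * ((i + j).factorial * g (i + j)) * x * y + ((j + j).factorial * g (j + j)) * y ^ 2 := by
    intro x y
    have hlim := (((tendsto_fwdDiff_iter_div_pow hG (i + i)).mul_const (x ^ 2)).add
      ((((tendsto_fwdDiff_iter_div_pow hG (i + j)).const_mul 2).mul_const x).mul_const y)).add
      ((tendsto_fwdDiff_iter_div_pow hG (j + j)).mul_const (y ^ 2))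
    refine ge_of_tendsto' hlim fun N => ?_
    set h : ℝ≥0 := 1 / ((N : ℝ≥0) + 1) with hh
    have hhr : (1 / ((N : ℝ) + 1)) = (h : ℝ) := by simp [hh]
    have hh0 : (h : ℝ) ≠ 0 := by rw [← hhr]; positivity
    rw [hhr]
    have hi : i < i + j + 1 := by omega
    have hj : j < i + j + 1 := by omega
    -- Weights of the difference operator `x h^{-i} Δ^i + y h^{-j} Δ^j`; the form at these weights
    -- is its square applied to `G` at `0`.
    have h1 := hpos (i + j + 1) (fun a => a * h) fun a =>
      x / (h : ℝ) ^ i * ((-1) ^ (i - (a : ℕ)) * i.choose a) +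
      y / (h : ℝ) ^ j * ((-1) ^ (j - (a : ℕ)) * j.choose a)
    have e1 := fwdDiff_iter_add_eq_sum G h hi hi
    have e2 := fwdDiff_iter_add_eq_sum G h hi hj
    have e3 := fwdDiff_iter_add_eq_sum G h hj hi
    have e4 := fwdDiff_iter_add_eq_sum G h hj hj
    have e : (fwdDiff h)^[i + i] G 0 / (h : ℝ) ^ (i + i) * x ^ 2 +
        2 * ((fwdDiff h)^[i + j] G 0 / (h : ℝ) ^ (i + j)) * x * y +
        (fwdDiff h)^[j + j] G 0 / (h : ℝ) ^ (j + j) * y ^ 2 =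
        x / (h : ℝ) ^ i * (x / (h : ℝ) ^ i) * (fwdDiff h)^[i + i] G 0 +
        x / (h : ℝ) ^ i * (y / (h : ℝ) ^ j) * (fwdDiff h)^[i + j] G 0 +
        x / (h : ℝ) ^ i * (y / (h : ℝ) ^ j) * (fwdDiff h)^[j + i] G 0 +
        y / (h : ℝ) ^ j * (y / (h : ℝ) ^ j) * (fwdDiff h)^[j + j] G 0 := by
      rw [pow_add, pow_add, pow_add, add_comm j i]
      field_simp
      ring
    rw [e, e1, e2, e3, e4]
    refine h1.trans_eq ?_
    simp only [mul_sum, ← sum_add_distrib]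
    refine sum_congr rfl fun a _ => sum_congr rfl fun b _ => ?_
    ring
  have hdisc := discrim_le_zero (a := (i + i).factorial * g (i + i))
    (b := 2 * ((i + j).factorial * g (i + j))) (c := (j + j).factorial * g (j + j)) fun x => by
      have := key x 1
      linarith
  rw [discrim] at hdisc
  linarith

/-! ### The square of the Schoenberg kernel in dimension `2 n` -/

/-- The Hankel moments of the square of the Schoenberg kernel in dimension `2 n`. -/
def sqMoment (n k : ℕ) : ℝ := k.factorial * risingFactorial n k * besselSqCoeff (n / 2) k

theorem sqMoment_pos {n : ℕ} (hn : 1 ≤ n) (k : ℕ) : 0 < sqMoment n k := by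
  have hn0 : (0 : ℝ) < n := by exact_mod_cast hn
  have h1 := risingFactorial_pos hn0 k
  have h2 := besselSqCoeff_pos (half_pos hn0) k
  unfold sqMoment
  positivity

theorem sqMoment_succ {n : ℕ} (hn : 1 ≤ n) (k : ℕ) :
    sqMoment n (k + 1) * ((n + k - 1) * (n + 2 * k)) =
      sqMoment n k * (4 * (n + k) * (n + 2 * k - 1)) := by
  have hn0 : (0 : ℝ) < n := by exact_mod_cast hn
  have h := besselSqCoeff_succ (half_pos hn0) k
  rw [sqMoment, sqMoment, risingFactorial_succ, Nat.factorial_succ]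
  push_cast
  linear_combination (2 * k.factorial * risingFactorial n k * (n + k)) * h

/-- A crude geometric growth bound, needed only for summability. At `k = 0` the factor `n + k - 1`
may vanish, so that case is excluded. -/
theorem sqMoment_succ_le {n : ℕ} (hn : 1 ≤ n) {k : ℕ} (hk : 1 ≤ k) :
    sqMoment n (k + 1) ≤ 8 * sqMoment n k := by
  have hn0 : (1 : ℝ) ≤ n := by exact_mod_cast hn
  have hk0 : (1 : ℝ) ≤ k := by exact_mod_cast hk
  have h := sqMoment_succ hn k
  have hp := sqMoment_pos hn k
  have hc : (0 : ℝ) < (n + k - 1) * (n + 2 * k) := mul_pos (by linarith) (by linarith)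
  rw [← mul_le_mul_iff_left₀ hc, h, mul_comm 8, mul_assoc _ 8]
  refine mul_le_mul_of_nonneg_left ?_ hp.le
  nlinarith

theorem sqMoment_le {n : ℕ} (hn : 1 ≤ n) (k : ℕ) :
    sqMoment n k ≤ (sqMoment n 0 + sqMoment n 1) * 8 ^ k := by
  have h0 := sqMoment_pos hn 0
  have h1 := sqMoment_pos hn 1
  cases k with
  | zero => simp; exact h1.le
  | succ k =>
    induction k with
    | zero => simp; linarith
    | succ k ih =>
      have h := sqMoment_succ_le hn (k := k + 1) (by omega)
      rw [pow_succ]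
      linarith

theorem hasSum_gaussianMean_schoenbergKernel_sq {n : ℕ} (hn : 1 ≤ n) (s : ℝ≥0) :
    HasSum (fun k => ((-1 / 2) ^ k * sqMoment n k / k.factorial) * (s : ℝ) ^ k)
      (gaussianMean (2 * n) (fun t => schoenbergKernel n t ^ 2) s) := by
  have hdim : ((2 * n : ℕ) : ℝ) / 2 = n := by push_cast; ring
  have hn0 : (0 : ℝ) < n := by exact_mod_cast hn
  have hk : ∀ k : ℕ, besselSqCoeff (n / 2) k * (-1 / 4) ^ k * (2 * (s : ℝ)) ^ k *
      risingFactorial ((2 * n : ℕ) / 2) k =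
      ((-1 / 2) ^ k * sqMoment n k / k.factorial) * (s : ℝ) ^ k := by
    intro k
    have hf : (k.factorial : ℝ) ≠ 0 := by positivity
    rw [hdim, sqMoment, show (-1 / 2 : ℝ) = -1 / 4 * 2 by norm_num, mul_pow, mul_pow]
    field_simp
  have h := hasSum_gaussianMean (m := 2 * n) (by omega) (f := fun t => schoenbergKernel n t ^ 2)
    (e := fun k => besselSqCoeff (n / 2) k * (-1 / 4) ^ k)
    (fun t => by
      refine HasSum.congr_fun (hasSum_schoenbergKernel_sq hn t) fun k => ?_
      rw [show -((t : ℝ) ^ 2 / 4) = -1 / 4 * t ^ 2 by ring, mul_pow, ← pow_mul]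
      ring) s (by
      refine Summable.of_nonneg_of_le (fun k => ?_) (fun k => ?_)
        ((Real.summable_pow_div_factorial (8 * (s / 2))).mul_left (sqMoment n 0 + sqMoment n 1))
      · rw [hdim]
        have := risingFactorial_pos hn0 k
        positivity
      · have h1 := sqMoment_le hn k
        have hf : (k.factorial : ℝ) ≠ 0 := by positivity
        rw [hdim, abs_mul, abs_of_pos (besselSqCoeff_pos (half_pos hn0) k), abs_pow]
        calc besselSqCoeff (n / 2) k * |(-1 / 4 : ℝ)| ^ k * (2 * (s : ℝ)) ^ k * risingFactorial n k
            = sqMoment n k * ((s / 2) ^ k / k.factorial) := by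
              rw [sqMoment, show |(-1 / 4 : ℝ)| = 1 / 4 by norm_num [abs_div],
                show (s : ℝ) / 2 = 1 / 4 * (2 * s) by ring, mul_pow (1 / 4 : ℝ)]
              field_simp
          _ ≤ (sqMoment n 0 + sqMoment n 1) * 8 ^ k * ((s / 2) ^ k / k.factorial) := by gcongr
          _ = _ := by rw [mul_pow]; ring)
  simp_rw [hk] at h
  exact h

/-- The ratio of consecutive moments is `4 (1 + k / ((n + k - 1)(n + 2k)))` for `k ≥ 1`. It
decreases to `4` for large `k`, whereas the Hankel inequality would require it not to decrease from
an even `k` to `k + 1`. -/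
theorem not_isRadialPosDef_schoenbergKernel_sq {n : ℕ} (hn : 1 ≤ n) :
    ¬ IsRadialPosDef (2 * n) fun t => schoenbergKernel n t ^ 2 := by
  intro hpd
  have hC : ∀ t : ℝ≥0, |schoenbergKernel n t ^ 2| ≤ 1 := fun t => by
    rw [abs_pow]
    exact pow_le_one₀ (abs_nonneg _) (abs_schoenbergKernel_le_one hn _)
  have hn0 : (1 : ℝ) ≤ n := by exact_mod_cast hn
  -- The indices `n` and `n + 1` compare the moments of orders `2n`, `2n + 1`, `2n + 2`, where the
  -- ratio is already decreasing for every `n`.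
  have h := hankel_sq_le_of_posDef (hasSum_gaussianMean_schoenbergKernel_sq hn)
    (fun p s c => hpd.sum_gaussianMean_nonneg hC s c) n (n + 1)
  have hval : ∀ k : ℕ, (k.factorial : ℝ) * ((-1 / 2) ^ k * sqMoment n k / k.factorial) =
      (-1 / 2) ^ k * sqMoment n k := fun k => by
    have hf : (k.factorial : ℝ) ≠ 0 := by positivity
    field_simp
  rw [hval, hval, hval] at h
  have e1 : n + (n + 1) = 2 * n + 1 := by ring
  have e2 : n + 1 + (n + 1) = 2 * n + 1 + 1 := by ring
  have e3 : n + n = 2 * n := by ring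
  rw [e1, e2, e3] at h
  have h1 := sqMoment_succ hn (2 * n)
  have h2 := sqMoment_succ hn (2 * n + 1)
  have p0 := sqMoment_pos hn (2 * n)
  have p1 := sqMoment_pos hn (2 * n + 1)
  generalize sqMoment n (2 * n) = A at *
  generalize sqMoment n (2 * n + 1) = B at *
  generalize sqMoment n (2 * n + 1 + 1) = D at *
  have h3 : B ^ 2 ≤ A * D := by
    have hq : (0 : ℝ) < ((-1 / 2) ^ (2 * n + 1)) ^ 2 := by positivity
    have : ((-1 / 2) ^ (2 * n + 1)) ^ 2 * B ^ 2 ≤ ((-1 / 2 : ℝ) ^ (2 * n + 1)) ^ 2 * (A * D) := by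
      calc _ = ((-1 / 2) ^ (2 * n + 1) * B) ^ 2 := by ring
        _ ≤ _ := h
        _ = _ := by ring
    exact le_of_mul_le_mul_left this hq
  push_cast at h1 h2
  generalize (n : ℝ) = x at *
  have h4 : B * (5 * (3 * x - 1)) = 12 * A * (5 * x - 1) :=
    mul_right_cancel₀ (by linarith : x ≠ 0) (by linear_combination h1)
  have h5 : B * (3 * x * (5 * x + 2)) ≤ 4 * A * ((3 * x + 1) * (5 * x + 1)) := by
    refine le_of_mul_le_mul_left ?_ p1
    calc B * (B * (3 * x * (5 * x + 2))) = B ^ 2 * (3 * x * (5 * x + 2)) := by ring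
      _ ≤ A * D * (3 * x * (5 * x + 2)) := by gcongr
      _ = B * (4 * A * ((3 * x + 1) * (5 * x + 1))) := by linear_combination A * h2
  -- Eliminating `A` leaves `9x(5x+2)(5x-1) - 5(3x-1)(3x+1)(5x+1) = 7x + 5`.
  have h6 : B * (7 * x + 5) ≤ 0 := by
    have h7 := mul_le_mul_of_nonneg_right h5 (by linarith : 0 ≤ 3 * (5 * x - 1))
    linear_combination h7 - (3 * x + 1) * (5 * x + 1) * h4
  nlinarith

/-! ### The square of the Schoenberg kernel in dimension `2 n - 1` -/

/-- `f` is radial positive definite on `ℝᵐ` and equals `∑ e k * t ^ (2 * k)`. -/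
def IsPosDefSeries (m : ℕ) (e : ℕ → ℝ) (f : ℝ≥0 → ℝ) : Prop :=
  IsRadialPosDef m f ∧ ∀ t : ℝ≥0, HasSum (fun k => e k * (t : ℝ) ^ (2 * k)) (f t)

theorem IsPosDefSeries.congr {m : ℕ} {e e' : ℕ → ℝ} {f : ℝ≥0 → ℝ} (hf : IsPosDefSeries m e f)
    (he : ∀ k, e' k = e k) : IsPosDefSeries m e' f := by
  rwa [funext he]

theorem IsPosDefSeries.average {m : ℕ} {e : ℕ → ℝ} {f : ℝ≥0 → ℝ} (hf : IsPosDefSeries m e f)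
    (p : ℕ) : IsPosDefSeries m (fun k => e k / (2 * k + p + 1))
      fun t => ∫ y in (0 : ℝ)..1, f (y.toNNReal * t) * y ^ p := by
  refine ⟨hf.1.integral_comp_mul p, fun t => ?_⟩
  have h := intervalIntegral.hasSum_integral_of_dominated_convergence (μ := volume) (a := 0) (b := 1)
    (F := fun (k : ℕ) (y : ℝ) => e k * (t : ℝ) ^ (2 * k) * y ^ (2 * k + p))
    (f := fun y => f (y.toNNReal * t) * y ^ p) (fun k _ => |e k * (t : ℝ) ^ (2 * k)|)
    (fun k => Continuous.aestronglyMeasurable (by fun_prop))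
    (fun k => .of_forall fun y hy => ?_) (.of_forall fun y _ => (hf.2 t).summable.abs)
    intervalIntegrable_const (.of_forall fun y hy => ?_)
  · refine HasSum.congr_fun h fun k => ?_
    rw [intervalIntegral.integral_const_mul, integral_pow]
    simp
    ring
  · rw [Set.uIoc_of_le zero_le_one] at hy
    rw [norm_mul, Real.norm_eq_abs, Real.norm_of_nonneg (pow_nonneg hy.1.le _)]
    exact mul_le_of_le_one_right (abs_nonneg _) (pow_le_one₀ hy.1.le hy.2)
  · rw [Set.uIoc_of_le zero_le_one] at hy
    refine HasSum.congr_fun ((hf.2 (y.toNNReal * t)).mul_right (y ^ p)) fun k => ?_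
    rw [NNReal.coe_mul, Real.coe_toNNReal _ hy.1.le]
    ring

theorem IsPosDefSeries.add_const_mul {m : ℕ} {e e' : ℕ → ℝ} {f f' : ℝ≥0 → ℝ}
    (hf : IsPosDefSeries m e f) (hf' : IsPosDefSeries m e' f') {r : ℝ} (hr : 0 ≤ r) :
    IsPosDefSeries m (fun k => e k + r * e' k) fun t => f t + r * f' t := by
  refine ⟨hf.1.add (hf'.1.const_mul hr), fun t => ?_⟩
  refine HasSum.congr_fun ((hf.2 t).add ((hf'.2 t).mul_left r)) fun k => ?_
  ring

/-- The multipliers relating the square of the Schoenberg kernel for `ℝⁿ` to the kernel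
for `ℝ²ⁿ⁻¹`. -/
def sqMultiplier (n i : ℕ) : ℝ := 1 + (n - 1) / ((2 * i + n - 1) * (2 * i + 2 * n - 1))

theorem one_le_sqMultiplier {n : ℕ} (hn : 2 ≤ n) (i : ℕ) : 1 ≤ sqMultiplier n i := by
  have h : (2 : ℝ) ≤ n := by exact_mod_cast hn
  have hi : (0 : ℝ) ≤ i := by positivity
  have : 0 ≤ ((n : ℝ) - 1) / ((2 * i + n - 1) * (2 * i + 2 * n - 1)) :=
    div_nonneg (by linarith) (mul_nonneg (by linarith) (by linarith))
  unfold sqMultiplier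
  linarith

theorem sqMultiplier_antitone {n : ℕ} (hn : 2 ≤ n) {i j : ℕ} (hij : i ≤ j) :
    sqMultiplier n j ≤ sqMultiplier n i := by
  have h : (2 : ℝ) ≤ n := by exact_mod_cast hn
  have hi : (0 : ℝ) ≤ i := by positivity
  have hij' : (i : ℝ) ≤ j := by exact_mod_cast hij
  unfold sqMultiplier
  have h1 : 0 ≤ (n : ℝ) - 1 := by linarith
  have h2 : 0 < 2 * (i : ℝ) + n - 1 := by linarith
  have h3 : 0 < 2 * (i : ℝ) + 2 * n - 1 := by linarith
  have h4 : 0 ≤ 2 * (j : ℝ) + n - 1 := by linarith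
  gcongr

theorem tendsto_sqMultiplier (n k : ℕ) :
    Filter.Tendsto (fun N => sqMultiplier n (k + N)) Filter.atTop (nhds 1) := by
  have h1 : Filter.Tendsto (fun N : ℕ => 2 * ((k + N : ℕ) : ℝ) + n - 1) Filter.atTop
      Filter.atTop := by
    refine Filter.tendsto_atTop_mono (f := fun N : ℕ => (N : ℝ) + -1) (fun N => ?_)
      (Filter.tendsto_atTop_add_const_right _ _ tendsto_natCast_atTop_atTop)
    push_cast
    have : (0 : ℝ) ≤ k := by positivity
    have : (0 : ℝ) ≤ n := by positivity
    have : (0 : ℝ) ≤ N := by positivity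
    linarith
  have h2 : Filter.Tendsto (fun N : ℕ => 2 * ((k + N : ℕ) : ℝ) + 2 * n - 1) Filter.atTop
      Filter.atTop := by
    refine Filter.tendsto_atTop_mono (fun N => ?_) h1
    have : (0 : ℝ) ≤ n := by positivity
    linarith
  have h3 := ((h1.atTop_mul_atTop₀ h2).const_div_atTop ((n : ℝ) - 1)).const_add 1
  rw [add_zero] at h3
  exact h3

/-- The product of `N` consecutive multipliers, starting from the `k`-th one. -/
def sqMultiplierProd (n N k : ℕ) : ℝ := ∏ j ∈ range N, sqMultiplier n (k + j)

theorem sqMultiplierProd_succ (n N k : ℕ) :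
    sqMultiplierProd n (N + 1) k = sqMultiplierProd n N k * sqMultiplier n (k + N) :=
  prod_range_succ _ _

theorem sqMultiplierProd_pos {n : ℕ} (hn : 2 ≤ n) (N k : ℕ) : 0 < sqMultiplierProd n N k :=
  prod_pos fun _ _ => zero_lt_one.trans_le (one_le_sqMultiplier hn _)

/-- This bounds the normalised products by `1` uniformly in `N`, the domination needed for the
limit. -/
theorem sqMultiplierProd_le {n : ℕ} (hn : 2 ≤ n) (N k : ℕ) :
    sqMultiplierProd n N k ≤ sqMultiplierProd n N 0 :=
  prod_le_prod (fun _ _ => (zero_lt_one.trans_le (one_le_sqMultiplier hn _)).le)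
    fun _ _ => sqMultiplier_antitone hn (by omega)

theorem sqMultiplierProd_succ_right (n N k : ℕ) :
    sqMultiplierProd n N (k + 1) * sqMultiplier n k =
      sqMultiplierProd n N k * sqMultiplier n (k + N) := by
  have h2 : sqMultiplierProd n (N + 1) k = sqMultiplierProd n N (k + 1) * sqMultiplier n k := by
    rw [sqMultiplierProd, prod_range_succ', sqMultiplierProd]
    congr 1
    refine prod_congr rfl fun j _ => ?_
    congr 1
    ring
  rw [← sqMultiplierProd_succ, h2]

/-- Shifting `k` by one drops the factor `m_k` and gains `m_{k+N}`, which tends to `1`. -/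
theorem tendsto_sqMultiplierProd_div {n : ℕ} (hn : 2 ≤ n) (k : ℕ) :
    Filter.Tendsto (fun N => sqMultiplierProd n N k / sqMultiplierProd n N 0) Filter.atTop
      (nhds (∏ i ∈ range k, (sqMultiplier n i)⁻¹)) := by
  induction k with
  | zero =>
    simp_rw [div_self (sqMultiplierProd_pos hn _ 0).ne']
    simp
  | succ k ih =>
    have h := (ih.mul (tendsto_sqMultiplier n k)).mul_const (sqMultiplier n k)⁻¹
    rw [mul_one, ← prod_range_succ] at h
    refine h.congr fun N => ?_
    have h1 := (zero_lt_one.trans_le (one_le_sqMultiplier hn k)).ne'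
    have h2 := sqMultiplierProd_succ_right n N k
    rw [div_mul_eq_mul_div, ← h2]
    field_simp

/-- The coefficients of the kernel `t ↦ Ω₂ₙ₋₁(2 t)`. -/
def doubledCoeff (n k : ℕ) : ℝ := (-1) ^ k / (k.factorial * risingFactorial ((2 * n - 1 : ℕ) / 2) k)

/-- Averaging with weight `y ^ p` divides the `k`-th coefficient by `2k + p + 1`. Two averages, with
`p = 2N + n - 2` and `p = 2N + 2n - 2`, produce the denominator of `m_{k+N} - 1`; adding `n - 1`
times the result to the function multiplies its coefficients by `m_{k+N}`. -/
theorem exists_isPosDefSeries_sqMultiplierProd {n : ℕ} (hn : 2 ≤ n) (N : ℕ) :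
    ∃ f, IsPosDefSeries (2 * n - 1) (fun k => sqMultiplierProd n N k * doubledCoeff n k) f := by
  have hn' : (2 : ℝ) ≤ n := by exact_mod_cast hn
  induction N with
  | zero =>
    refine ⟨fun t => schoenbergKernel (2 * n - 1) ((2 : ℝ≥0) * t : ℝ≥0),
      (schoenbergKernel_isRadialPosDef (by omega)).comp_mul 2, fun t => ?_⟩
    refine HasSum.congr_fun (hasSum_schoenbergKernel (by omega) _) fun k => ?_
    simp only [sqMultiplierProd, range_zero, prod_empty, doubledCoeff]
    push_cast
    rw [show -((2 * (t : ℝ)) ^ 2 / 4) = -1 * t ^ 2 by ring, mul_pow (-1 : ℝ), ← pow_mul]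
    ring
  | succ N ih =>
    obtain ⟨f, hf⟩ := ih
    have h := hf.add_const_mul ((hf.average (2 * N + n - 2)).average (2 * N + 2 * n - 2))
      (r := n - 1) (by linarith)
    refine ⟨_, h.congr fun k => ?_⟩
    rw [sqMultiplierProd_succ, sqMultiplier]
    have e1 : ((2 * N + n - 2 : ℕ) : ℝ) = 2 * N + n - 2 := by
      rw [Nat.cast_sub (by omega)]; push_cast; ring
    have e2 : ((2 * N + 2 * n - 2 : ℕ) : ℝ) = 2 * N + 2 * n - 2 := by
      rw [Nat.cast_sub (by omega)]; push_cast; ring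
    have hk : (0 : ℝ) ≤ k := by positivity
    have hN : (0 : ℝ) ≤ N := by positivity
    have h1 : 2 * ((k : ℝ) + N) + n - 1 ≠ 0 := by linarith
    have h2 : 2 * ((k : ℝ) + N) + 2 * n - 1 ≠ 0 := by linarith
    have h3 : 2 * ((k : ℝ) + N + n) - 1 ≠ 0 := by linarith
    rw [e1, e2, show 2 * (k : ℝ) + (2 * N + n - 2) + 1 = 2 * (k + N) + n - 1 by ring,
      show 2 * (k : ℝ) + (2 * N + 2 * n - 2) + 1 = 2 * (k + N) + 2 * n - 1 by ring]
    push_cast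
    field_simp

/-- Both sides are `1` at `k = 0` and satisfy the same first-order recurrence; `m_i` is defined so
that this holds. -/
theorem prod_inv_sqMultiplier_mul_doubledCoeff {n : ℕ} (hn : 2 ≤ n) (k : ℕ) :
    (∏ i ∈ range k, (sqMultiplier n i)⁻¹) * doubledCoeff n k =
      besselSqCoeff (n / 2) k * (-1 / 4) ^ k := by
  have hn' : (2 : ℝ) ≤ n := by exact_mod_cast hn
  have hdim : ((2 * n - 1 : ℕ) : ℝ) / 2 = n - 1 / 2 := by
    rw [Nat.cast_sub (by omega)]; push_cast; ring
  induction k with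
  | zero => simp [doubledCoeff]
  | succ k ih =>
    have hk : (0 : ℝ) ≤ k := by positivity
    have h1 : 2 * (k : ℝ) + n - 1 ≠ 0 := by linarith
    have h2 : 2 * (k : ℝ) + 2 * n - 1 ≠ 0 := by linarith
    have h2' : 2 * ((k : ℝ) + n) - 1 ≠ 0 := by linarith
    have h3 : 2 * (k : ℝ) + n ≠ 0 := by linarith
    have h4 : (k : ℝ) + n - 1 ≠ 0 := by linarith
    have h5 : (k : ℝ) + 1 ≠ 0 := by linarith
    have hm : (sqMultiplier n k)⁻¹ = (2 * k + n - 1) * (2 * k + 2 * n - 1) /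
        (2 * ((2 * k + n) * (k + n - 1))) := by
      rw [← inv_div]
      congr 1
      unfold sqMultiplier
      field_simp
      ring
    have hd : doubledCoeff n (k + 1) = doubledCoeff n k * (-2 / ((k + 1) * (2 * k + 2 * n - 1))) := by
      rw [doubledCoeff, doubledCoeff, risingFactorial_succ, Nat.factorial_succ, hdim]
      have hr := (risingFactorial_pos (by linarith : (0 : ℝ) < n - 1 / 2) k).ne'
      have hf : (k.factorial : ℝ) ≠ 0 := by positivity
      have h6 : (n : ℝ) - 1 / 2 + k ≠ 0 := by linarith
      have h7 : (n : ℝ) - 1 / 2 + k = (2 * k + 2 * n - 1) / 2 := by ring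
      rw [h7]
      push_cast
      field_simp
      ring
    have hs : besselSqCoeff (n / 2) (k + 1) = besselSqCoeff (n / 2) k *
        (4 * (2 * k + n - 1) / ((k + n - 1) * (k + 1) * (2 * k + n))) := by
      have h := besselSqCoeff_succ (by linarith : (0 : ℝ) < n / 2) k
      rw [mul_div_assoc', eq_div_iff (by positivity)]
      linear_combination 2 * h
    rw [prod_range_succ, hd, hs, hm]
    have : ∀ A B C D : ℝ, A * B * (C * D) = A * C * (B * D) := by intros; ring
    rw [this, ih, pow_succ]
    field_simp

theorem schoenbergKernel_sq_isRadialPosDef {n : ℕ} (hn : 1 ≤ n) :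
    IsRadialPosDef (2 * n - 1) fun t => schoenbergKernel n t ^ 2 := by
  rcases Nat.lt_or_ge n 2 with h | h2
  -- For `n = 1` the formula for `m_0` degenerates to `0/0`, but `2n - 1 = n` and the square is a
  -- product of two kernels on the same space.
  · obtain rfl : n = 1 := by omega
    simpa [sq] using schoenbergKernel_mul_schoenbergKernel_isRadialPosDef le_rfl 1 1
  have hc := continuous_schoenbergKernel hn
  choose f hf using exists_isPosDefSeries_sqMultiplierProd h2
  refine isRadialPosDef_of_tendsto (by fun_prop)
    (fun N => (hf N).1.const_mul (inv_nonneg.2 (sqMultiplierProd_pos h2 N 0).le)) fun t => ?_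
  have h0 : ∀ t : ℝ≥0, Summable fun k => |doubledCoeff n k * (t : ℝ) ^ (2 * k)| := fun t => by
    have := ((hf 0).2 t).summable.abs
    simpa [sqMultiplierProd] using this
  have hsq : ∑' k, (∏ i ∈ range k, (sqMultiplier n i)⁻¹) * (doubledCoeff n k * (t : ℝ) ^ (2 * k)) =
      schoenbergKernel n t ^ 2 := by
    rw [← (hasSum_schoenbergKernel_sq hn t).tsum_eq]
    refine tsum_congr fun k => ?_
    rw [← mul_assoc, prod_inv_sqMultiplier_mul_doubledCoeff h2,
      show -((t : ℝ) ^ 2 / 4) = -1 / 4 * t ^ 2 by ring, mul_pow, ← pow_mul]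
    ring
  rw [← hsq]
  have hN : ∀ N, (sqMultiplierProd n N 0)⁻¹ * f N t = ∑' k, sqMultiplierProd n N k /
      sqMultiplierProd n N 0 * (doubledCoeff n k * (t : ℝ) ^ (2 * k)) := fun N => by
    rw [← ((hf N).2 t).tsum_eq, ← tsum_mul_left]
    refine tsum_congr fun k => ?_
    ring
  simp_rw [hN]
  -- Coefficientwise limits suffice: the normalised products lie in `[0, 1]`, so the series of
  -- `Ω_{2n-1}(2t)` dominates.
  refine tendsto_tsum_of_dominated_convergence (h0 t)
    (fun k => (tendsto_sqMultiplierProd_div h2 k).mul_const _) (.of_forall fun N k => ?_)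
  rw [norm_mul, Real.norm_of_nonneg (div_nonneg (sqMultiplierProd_pos h2 N k).le
    (sqMultiplierProd_pos h2 N 0).le), Real.norm_eq_abs]
  exact mul_le_of_le_one_left (abs_nonneg _)
    ((div_le_one (sqMultiplierProd_pos h2 N 0)).2 (sqMultiplierProd_le h2 N k))

theorem theorem1p2 (n : ℕ) (hn : 1 ≤ n) :
    (∀ a b : ℝ, 0 ≤ a → 0 ≤ b → a ≠ b →
      (fun t : ℝ≥0 => schoenbergKernel n (a * t) * schoenbergKernel n (b * t)) ∈
        radialPosDefClass n \ radialPosDefClass (n + 1)) ∧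
    (fun t : ℝ≥0 => schoenbergKernel n t ^ 2) ∈
      radialPosDefClass (2 * n - 1) \ radialPosDefClass (2 * n) :=
  ⟨fun a b ha hb hab => ⟨schoenbergKernel_mul_schoenbergKernel_isRadialPosDef hn a b,
    not_isRadialPosDef_schoenbergKernel_mul_schoenbergKernel hn ha hb hab⟩,
    schoenbergKernel_sq_isRadialPosDef hn, not_isRadialPosDef_schoenbergKernel_sq hn⟩

end
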